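/- Equip $\mathbb{R}^2$ with the Euclidean norm, let $\|\cdot\|$ be the associated operator norm on $2\times 2$ real matrices, and let $\mathbb{RP}^1$ be the real projective line, i.e. the set of lines through the origin in $\mathbb{R}^2$ with its usual topology, on which $GL_2(\mathbb{R})$ acts by $V\mapsto AV$. A closed projective interval is a set of the form $\{\mathbb{R}(\cos\theta,\sin\theta) : a\le\theta\le b\}$ with $a<b<a+\pi$. A multicone is a nonempty proper subset of $\mathbb{RP}^1$ which is a finite union of closed projective intervals. A strongly invariant multicone for $\mathsf{A}\subset GL_2(\mathbb{R})$ is a multicone $\mathcal{C}$ such that $A\mathcal{C}\subset\mathcal{C}^o$ for all $A\in\mathsf{A}$, where $\mathcal{C}^o$ is the interior of $\mathcal{C}$. A set $\mathsf{A}$ is dominated if there are constants $C>0$ and $0<\tau<1$ such that $|\det(A_1\cdots A_n)|\le C\tau^n\|A_1\cdots A_n\|^2$ for all $n\ge 1$ and $A_1,\dots,A_n\in\mathsf{A}$. A matrix is proximal if it has two real eigenvalues with unequal absolute values. Let $\mathcal{S}(\mathsf{A})=\{A_1\cdots A_n : n\ge 1,\ A_1,\dots,A_n\in\mathsf{A}\}$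 be the sub-semigroup generated by $\mathsf{A}$. A semigroup $\mathcal{S}\subset GL_2(\mathbb{R})$ is almost multiplicative if there is $\kappa>0$ such that $\|AB\|\ge\kappa\|A\|\|B\|$ for all $A,B\in\mathcal{S}$. Corollary 2.4. If $\mathsf{A}\subset GL_2(\mathbb{R})$ is compact, then the following two statements are equivalent: (1) $\mathsf{A}$ has a strongly invariant multicone (equivalently, $\mathsf{A}$ is dominated); (2) $\mathsf{A}$ contains only proximal matrices and $\mathcal{S}(\mathsf{A})$ is almost multiplicative. The equivalence stated in parentheses in (1) is part of the assertion. -/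

import Mathlib

open scoped LinearAlgebra.Projectivization MatrixGroups Pointwise

noncomputable section

namespace PlanarCocycle

/-- The real projective line: the set of all lines through the origin in the plane. -/
abbrev RP1 : Type := ℙ ℝ (Fin 2 → ℝ)

/-- The quotient topology on the real projective line. -/
instance instTopologicalSpaceRP1 : TopologicalSpace RP1 :=
  TopologicalSpace.coinduced (Projectivization.mk' ℝ) inferInstance

/-- The direction vector `(cos θ, sin θ)` is nonzero. -/
theorem direction_ne_zero (θ : ℝ) : (![Real.cos θ, Real.sin θ] : Fin 2 → ℝ) ≠ 0 := by
  intro h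
  have h0 : Real.cos θ = 0 := by simpa using congrFun h 0
  have h1 : Real.sin θ = 0 := by simpa using congrFun h 1
  have := Real.cos_sq_add_sin_sq θ
  simp [h0, h1] at this

/-- The line through the origin at angle `θ`. -/
def lineAt (θ : ℝ) : RP1 :=
  Projectivization.mk ℝ ![Real.cos θ, Real.sin θ] (direction_ne_zero θ)

/-- Closed projective intervals: the nondegenerate proper closed arcs of the projective line,
i.e. the sets of lines whose angle ranges over `[a, b]`, where `a < b < a + π`. -/
def IsClosedProjectiveInterval (I : Set RP1) : Prop :=
  ∃ a b : ℝ, a < b ∧ b < a + Real.pi ∧ I = lineAt '' Set.Icc a b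

/-- A multicone: a nonempty proper subset of the projective line which is a finite union of
closed projective intervals. -/
def IsMulticone (C : Set RP1) : Prop :=
  C.Nonempty ∧ C ≠ Set.univ ∧
    ∃ F : Set (Set RP1), F.Finite ∧ (∀ I ∈ F, IsClosedProjectiveInterval I) ∧ C = ⋃₀ F

/-- `C` is a strongly invariant multicone for `𝒜`: it is a multicone and `A C ⊆ int C` for all
`A ∈ 𝒜`. The set `A • C` is the image of `C` under the projective action of `A`. -/
def IsStronglyInvariantMulticone (𝒜 : Set (GL (Fin 2) ℝ)) (C : Set RP1) : Prop :=
  IsMulticone C ∧ ∀ A ∈ 𝒜, A • C ⊆ interior C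

/-- The operator norm of a matrix with respect to the Euclidean norm on the plane. -/
def opNorm (A : GL (Fin 2) ℝ) : ℝ :=
  ‖Matrix.toEuclideanCLM (n := Fin 2) (𝕜 := ℝ) (A : Matrix (Fin 2) (Fin 2) ℝ)‖

/-- Domination: `|det (A₁ ⋯ Aₙ)| / ‖A₁ ⋯ Aₙ‖² ≤ c τⁿ` for all `n ≥ 1` and `A₁, …, Aₙ ∈ 𝒜`, with
constants `c > 0` and `0 < τ < 1`. -/
def IsDominated (𝒜 : Set (GL (Fin 2) ℝ)) : Prop :=
  ∃ c τ : ℝ, 0 < c ∧ 0 < τ ∧ τ < 1 ∧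
    ∀ l : List (GL (Fin 2) ℝ), l ≠ [] → (∀ A ∈ l, A ∈ 𝒜) →
      |(l.prod : Matrix (Fin 2) (Fin 2) ℝ).det| / opNorm l.prod ^ 2 ≤ c * τ ^ l.length

/-- A matrix is proximal if it has two real eigenvalues with unequal absolute values. -/
def IsProximal (A : GL (Fin 2) ℝ) : Prop :=
  ∃ r s : ℝ, |r| ≠ |s| ∧
    Module.End.HasEigenvalue (Matrix.toLin' (A : Matrix (Fin 2) (Fin 2) ℝ)) r ∧
    Module.End.HasEigenvalue (Matrix.toLin' (A : Matrix (Fin 2) (Fin 2) ℝ)) s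

/-- A semigroup of invertible matrices is almost multiplicative if `‖A B‖ ≥ κ ‖A‖ ‖B‖` on it for
some constant `κ > 0`. -/
def IsAlmostMultiplicative (S : Subsemigroup (GL (Fin 2) ℝ)) : Prop :=
  ∃ κ : ℝ, 0 < κ ∧ ∀ A ∈ S, ∀ B ∈ S, κ * opNorm A * opNorm B ≤ opNorm (A * B)

end PlanarCocycle

end

/-!
The three properties are proved to imply each other in the cycle: strongly invariant multicone,
then proximality together with almost multiplicativity, then domination, then multicone. Dividing
every matrix by `|det|^(1/2)` changes none of them, so all estimates are about `normalize A`,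
which has determinant `±1`: domination says that the norms of products grow exponentially with the
number of factors, and almost multiplicativity that the norm is multiplicative up to a constant on
the semigroup `S`. The area form `area`, preserved up to sign, measures angles between lines.

*Multicone to almost multiplicativity.* Let `K` be the cone over the multicone. For `A ∈ S ∪ {1}`,
preimages under `A` of vectors outside `K` stay at a definite angle from `B K`, for every `B ∈ 𝒜`.
Applied to a basis outside `K`, this bounds `‖A v‖` from below by a multiple of `‖A‖ ‖v‖` for `v ∈
B K` (`IsInvariantCone.exists_expansion`), which gives almost multiplicativity. By
Cayley-Hamilton, if `A ∈ 𝒜` is not proximal then its normalized powers are bounded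
(`isProximal_of_norm_pow`), so some power is close to the identity; it then cannot move a boundary
line of the multicone into the interior (`IsInvariantCone.isProximal`).

*Almost multiplicativity to domination.* If the norm does not grow exponentially, almost
multiplicativity yields words of any length all of whose subwords have bounded norm. By
compactness some subword is close to the identity, so that its first letter is nearly inverted by
an element of `S`. In the limit, some `A ∈ 𝒜` satisfies `κ ‖A^n‖ ≤ κ ‖A^n‖ ‖A^(-n)‖ ≤ 1` for all
`n`, which is false for a proximal matrix (`exists_length_norm_ge`).

*Domination to multicone.* The first step is that domination implies almost multiplicativity. In
frames adapted to an orbit `v k`, the matrices are triangular, whence the bound `norm_stepProd_le`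
on the norm of a product by sums of `‖v k‖⁻²`. With exponential growth, this prevents an orbit
from being much longer at some time than at a time before and at a time after (`exists_dichotomy`:
consider the last earlier and the first later time at which the orbit drops below a threshold).
Hence the direction most contracted by `A` is uniformly transverse to the image of the direction
most expanded by `B`, which is almost multiplicativity of `‖A B‖`
(`IsDominated.isAlmostMultiplicative`). The cones of vectors uniformly expanded by all of `S` are
then mapped into a fixed one by all long words, and slightly widening them at each of finitely
many steps produces an open cone mapped by `𝒜` into a compact part of itself
(`exists_absorbing_cone`); finitely many closed intervals inside the cone cover this compact part.
-/

namespace PlanarCocycle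

noncomputable section

open Filter Topology
open scoped Matrix.Norms.L2Operator

/-! ### The Euclidean plane: norm, area form, operator norm -/

/-- The Euclidean norm of a vector of `Fin 2 → ℝ` (whose own norm in Mathlib is the sup norm). -/
def vnorm (v : Fin 2 → ℝ) : ℝ := ‖WithLp.toLp 2 v‖

/-- The standard area form on the plane. -/
def area (v w : Fin 2 → ℝ) : ℝ := v 0 * w 1 - v 1 * w 0

/-- Rotation by a right angle. -/
def rot (v : Fin 2 → ℝ) : Fin 2 → ℝ := ![-v 1, v 0]

theorem vnorm_sq (v : Fin 2 → ℝ) : vnorm v ^ 2 = v 0 ^ 2 + v 1 ^ 2 := by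
  simp [vnorm, EuclideanSpace.norm_sq_eq]

theorem vnorm_nonneg (v : Fin 2 → ℝ) : 0 ≤ vnorm v := norm_nonneg _

theorem vnorm_eq_zero {v : Fin 2 → ℝ} : vnorm v = 0 ↔ v = 0 := by
  simp [vnorm]

theorem vnorm_pos {v : Fin 2 → ℝ} : 0 < vnorm v ↔ v ≠ 0 := by
  rw [(vnorm_nonneg v).lt_iff_ne', ne_eq, vnorm_eq_zero]

theorem vnorm_smul (c : ℝ) (v : Fin 2 → ℝ) : vnorm (c • v) = |c| * vnorm v := by
  simp [vnorm, norm_smul]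

theorem vnorm_add_le (v w : Fin 2 → ℝ) : vnorm (v + w) ≤ vnorm v + vnorm w := by
  simpa [vnorm] using norm_add_le (WithLp.toLp 2 v) (WithLp.toLp 2 w)

theorem vnorm_sub_le (v w : Fin 2 → ℝ) : vnorm v ≤ vnorm w + vnorm (v - w) := by
  simpa using vnorm_add_le w (v - w)

theorem vnorm_sub_comm (v w : Fin 2 → ℝ) : vnorm (v - w) = vnorm (w - v) := by
  simpa [vnorm] using norm_sub_rev (WithLp.toLp 2 v) (WithLp.toLp 2 w)

theorem continuous_vnorm : Continuous vnorm :=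
  continuous_norm.comp (PiLp.continuous_toLp 2 _)

@[fun_prop]
theorem _root_.Continuous.vnorm {X : Type*} [TopologicalSpace X] {f : X → Fin 2 → ℝ}
    (hf : Continuous f) : Continuous fun x => vnorm (f x) :=
  continuous_vnorm.comp hf

@[fun_prop]
theorem _root_.Continuous.area {X : Type*} [TopologicalSpace X] {f g : X → Fin 2 → ℝ}
    (hf : Continuous f) (hg : Continuous g) : Continuous fun x => area (f x) (g x) := by
  unfold PlanarCocycle.area
  fun_prop

theorem isCompact_unit : IsCompact {v : Fin 2 → ℝ | vnorm v = 1} := by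
  have h := (isCompact_sphere (0 : EuclideanSpace ℝ (Fin 2)) 1).image
    (PiLp.continuous_ofLp 2 (fun _ : Fin 2 => ℝ))
  convert h using 1
  ext v
  constructor
  · intro hv
    exact ⟨WithLp.toLp 2 v, by simpa [vnorm] using hv, rfl⟩
  · rintro ⟨w, hw, rfl⟩
    simpa [vnorm] using hw

theorem isPreconnected_unit : IsPreconnected {v : Fin 2 → ℝ | vnorm v = 1} := by
  have hr : 1 < Module.rank ℝ (EuclideanSpace ℝ (Fin 2)) := by
    rw [← Module.finrank_eq_rank, finrank_euclideanSpace_fin]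
    norm_num
  have h := (isPreconnected_sphere hr (0 : EuclideanSpace ℝ (Fin 2)) 1).image _
    (PiLp.continuous_ofLp 2 (fun _ : Fin 2 => ℝ)).continuousOn
  convert h using 1
  ext v
  constructor
  · intro hv
    exact ⟨WithLp.toLp 2 v, by simpa [vnorm] using hv, rfl⟩
  · rintro ⟨w, hw, rfl⟩
    simpa [vnorm] using hw

theorem vnorm_unit {v : Fin 2 → ℝ} (hv : v ≠ 0) : vnorm ((vnorm v)⁻¹ • v) = 1 := by
  have := vnorm_pos.2 hv
  rw [vnorm_smul, abs_of_pos (inv_pos.2 this), inv_mul_cancel₀ this.ne']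

theorem area_smul_left (c : ℝ) (v w : Fin 2 → ℝ) : area (c • v) w = c * area v w := by
  simp [area]; ring

theorem area_smul_right (c : ℝ) (v w : Fin 2 → ℝ) : area v (c • w) = c * area v w := by
  simp [area]; ring

theorem area_self (v : Fin 2 → ℝ) : area v v = 0 := by
  simp [area]; ring

theorem area_add_right (v w z : Fin 2 → ℝ) : area v (w + z) = area v w + area v z := by
  simp [area]; ring

theorem area_sub_left (v w z : Fin 2 → ℝ) : area (v - w) z = area v z - area w z := by
  simp [area]; ring

theorem abs_area_le (v w : Fin 2 → ℝ) : |area v w| ≤ vnorm v * vnorm w := by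
  apply abs_le_of_sq_le_sq _ (mul_nonneg (vnorm_nonneg v) (vnorm_nonneg w))
  rw [mul_pow, vnorm_sq, vnorm_sq, area]
  nlinarith [sq_nonneg (v 0 * w 0 + v 1 * w 1)]

theorem area_rot (v : Fin 2 → ℝ) : area v (rot v) = vnorm v ^ 2 := by
  rw [vnorm_sq]; simp [area, rot]; ring

theorem vnorm_rot (v : Fin 2 → ℝ) : vnorm (rot v) = vnorm v := by
  rw [← pow_left_inj₀ (vnorm_nonneg _) (vnorm_nonneg _) two_ne_zero, vnorm_sq, vnorm_sq]
  simp [rot]; ring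

theorem area_mulVec (A : Matrix (Fin 2) (Fin 2) ℝ) (v w : Fin 2 → ℝ) :
    area (A.mulVec v) (A.mulVec w) = A.det * area v w := by
  simp [area, Matrix.det_fin_two, Matrix.mulVec, dotProduct, Fin.sum_univ_two]; ring

theorem abs_area_mulVec {A : Matrix (Fin 2) (Fin 2) ℝ} (hA : |A.det| = 1) (v w : Fin 2 → ℝ) :
    |area (A.mulVec v) (A.mulVec w)| = |area v w| := by
  rw [area_mulVec, abs_mul, hA, one_mul]

/-- Vectors with vanishing area are proportional. -/
theorem exists_smul_of_area_eq_zero {v w : Fin 2 → ℝ} (hv : v ≠ 0) (h : area v w = 0) :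
    ∃ c : ℝ, w = c • v := by
  have hpos := vnorm_pos.2 hv
  refine ⟨(v 0 * w 0 + v 1 * w 1) / vnorm v ^ 2, ?_⟩
  have h' : v 0 * w 1 = v 1 * w 0 := by unfold area at h; linarith
  ext i
  simp only [Pi.smul_apply, smul_eq_mul]
  rw [div_mul_eq_mul_div, eq_div_iff (by positivity), vnorm_sq]
  fin_cases i
  · simp only [Fin.zero_eta]; linear_combination -v 1 * h'
  · simp only [Fin.mk_one]; linear_combination v 0 * h'

/-- The decomposition of `w` along `v` and its normal; the normal component is an area. -/
theorem eq_smul_add_rot {v : Fin 2 → ℝ} (hv : v ≠ 0) (w : Fin 2 → ℝ) :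
    w = ((v 0 * w 0 + v 1 * w 1) / vnorm v ^ 2) • v + (area v w / vnorm v ^ 2) • rot v := by
  have hpos := vnorm_pos.2 hv
  ext i
  simp only [Pi.add_apply, Pi.smul_apply, smul_eq_mul]
  rw [div_mul_eq_mul_div, div_mul_eq_mul_div, ← add_div, eq_div_iff (by positivity), vnorm_sq]
  fin_cases i
  · simp [area, rot]; ring
  · simp [area, rot]; ring

theorem abs_dot_le (v w : Fin 2 → ℝ) : |v 0 * w 0 + v 1 * w 1| ≤ vnorm v * vnorm w := by
  apply abs_le_of_sq_le_sq _ (mul_nonneg (vnorm_nonneg v) (vnorm_nonneg w))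
  rw [mul_pow, vnorm_sq, vnorm_sq]
  nlinarith [sq_nonneg (v 0 * w 1 - v 1 * w 0)]

theorem vnorm_mulVec_le (A : Matrix (Fin 2) (Fin 2) ℝ) (v : Fin 2 → ℝ) :
    vnorm (A.mulVec v) ≤ ‖A‖ * vnorm v :=
  Matrix.l2_opNorm_mulVec A (WithLp.toLp 2 v)

theorem norm_le_of_vnorm_mulVec_le {A : Matrix (Fin 2) (Fin 2) ℝ} {c : ℝ} (hc : 0 ≤ c)
    (h : ∀ v, vnorm (A.mulVec v) ≤ c * vnorm v) : ‖A‖ ≤ c := by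
  rw [Matrix.cstar_norm_def]
  exact ContinuousLinearMap.opNorm_le_bound _ hc fun x => h x.ofLp

theorem exists_lt_vnorm_mulVec {A : Matrix (Fin 2) (Fin 2) ℝ} {c : ℝ} (hc : 0 ≤ c)
    (h : c < ‖A‖) : ∃ v, v ≠ 0 ∧ c * vnorm v < vnorm (A.mulVec v) := by
  by_contra! hcon
  refine h.not_ge (norm_le_of_vnorm_mulVec_le hc fun v => ?_)
  by_cases hv : v = 0
  · simp [hv, vnorm_eq_zero.2]
  · exact hcon v hv

theorem norm_one_matrix : ‖(1 : Matrix (Fin 2) (Fin 2) ℝ)‖ = 1 := by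
  rw [Matrix.cstar_norm_def]; simp

/-! ### Matrices of determinant `±1` -/

theorem vnorm_le_norm_mul_vnorm_mulVec {A : Matrix (Fin 2) (Fin 2) ℝ} (hA : |A.det| = 1)
    (v : Fin 2 → ℝ) : vnorm v ≤ ‖A‖ * vnorm (A.mulVec v) := by
  by_cases hv : v = 0
  · simp [hv, vnorm_eq_zero.2]
  have hpos := vnorm_pos.2 hv
  have h := abs_area_mulVec hA v (rot v)
  rw [area_rot, abs_of_nonneg (sq_nonneg (vnorm v))] at h
  have h1 := abs_area_le (A.mulVec v) (A.mulVec (rot v))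
  have h2 := vnorm_mulVec_le A (rot v)
  rw [vnorm_rot] at h2
  have h3 := mul_le_mul_of_nonneg_left h2 (vnorm_nonneg (A.mulVec v))
  refine le_of_mul_le_mul_right ?_ hpos
  nlinarith

theorem mulVec_ne_zero {A : Matrix (Fin 2) (Fin 2) ℝ} (hA : |A.det| = 1)
    {v : Fin 2 → ℝ} (hv : v ≠ 0) : A.mulVec v ≠ 0 := by
  intro h
  have := vnorm_le_norm_mul_vnorm_mulVec hA v
  rw [h, vnorm_eq_zero.2 rfl, mul_zero] at this
  exact (vnorm_pos.2 hv).not_ge this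

theorem one_le_norm {A : Matrix (Fin 2) (Fin 2) ℝ} (hA : |A.det| = 1) : 1 ≤ ‖A‖ := by
  have hv : (![1, 0] : Fin 2 → ℝ) ≠ 0 := fun h => by simpa using congrFun h 0
  have h0 := vnorm_pos.2 hv
  have h1 := vnorm_le_norm_mul_vnorm_mulVec hA ![1, 0]
  have h2 := mul_le_mul_of_nonneg_left (vnorm_mulVec_le A ![1, 0]) (norm_nonneg A)
  have h3 : 1 ≤ ‖A‖ * ‖A‖ := by
    refine le_of_mul_le_mul_right ?_ h0
    linarith
  nlinarith [norm_nonneg A]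

/-- A matrix of determinant `±1` contracts some direction about as much as it expands another. -/
theorem exists_contracted {A : Matrix (Fin 2) (Fin 2) ℝ} (hA : |A.det| = 1) :
    ∃ v, vnorm v = 1 ∧ vnorm (A.mulVec v) * ‖A‖ ≤ 2 := by
  have hn := one_le_norm hA
  obtain ⟨y, hy, hAy⟩ := exists_lt_vnorm_mulVec (A := A) (c := ‖A‖ / 2) (by positivity)
    (by linarith)
  have hy0 := vnorm_pos.2 hy
  have hunit : IsUnit A.det := by
    rw [isUnit_iff_ne_zero]
    intro h
    simp [h] at hA
  -- the preimage of the normal to the expanded vector `A y`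
  set z := A⁻¹.mulVec (rot (A.mulVec y)) with hz
  have hAz : A.mulVec z = rot (A.mulVec y) := by
    rw [hz, Matrix.mulVec_mulVec, Matrix.mul_nonsing_inv _ hunit, Matrix.one_mulVec]
  have hAy0 : 0 < vnorm (A.mulVec y) := lt_of_le_of_lt (by positivity) hAy
  have h1 := abs_area_mulVec hA y z
  rw [hAz, area_rot, abs_of_nonneg (sq_nonneg (vnorm _))] at h1
  have h2 := abs_area_le y z
  have hz0 : 0 < vnorm z := by
    by_contra hcon
    nlinarith [pow_pos hAy0 2]
  refine ⟨(vnorm z)⁻¹ • z, vnorm_unit (vnorm_pos.1 hz0), ?_⟩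
  rw [Matrix.mulVec_smul, hAz, vnorm_smul, vnorm_rot, abs_of_pos (inv_pos.2 hz0), mul_assoc,
    inv_mul_le_iff₀ hz0]
  refine le_of_mul_le_mul_right ?_ hy0
  nlinarith

/-! ### Normalization of the determinant -/

theorem det_ne_zero (A : GL (Fin 2) ℝ) : (A : Matrix (Fin 2) (Fin 2) ℝ).det ≠ 0 :=
  A.isUnit.map Matrix.detMonoidHom |>.ne_zero

/-- The normalized matrix `|det A|^(-1/2) A`, of determinant `±1`; a monoid homomorphism. -/
def normalize : GL (Fin 2) ℝ →* Matrix (Fin 2) (Fin 2) ℝ where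
  toFun A := (√|(A : Matrix (Fin 2) (Fin 2) ℝ).det|)⁻¹ • (A : Matrix (Fin 2) (Fin 2) ℝ)
  map_one' := by simp
  map_mul' A B := by
    simp only [Units.val_mul, Matrix.det_mul, abs_mul, Real.sqrt_mul (abs_nonneg _), mul_inv,
      Matrix.smul_mul, Matrix.mul_smul, smul_smul]
    rw [mul_comm]

theorem normalize_apply (A : GL (Fin 2) ℝ) : normalize A =
    (√|(A : Matrix (Fin 2) (Fin 2) ℝ).det|)⁻¹ • (A : Matrix (Fin 2) (Fin 2) ℝ) := rfl

theorem sqrt_abs_det_pos (A : GL (Fin 2) ℝ) :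
    0 < √|(A : Matrix (Fin 2) (Fin 2) ℝ).det| :=
  Real.sqrt_pos.2 (abs_pos.2 (det_ne_zero A))

theorem abs_det_normalize (A : GL (Fin 2) ℝ) : |(normalize A).det| = 1 := by
  have h := abs_pos.2 (det_ne_zero A)
  rw [normalize_apply, Matrix.det_smul, Fintype.card_fin, abs_mul, abs_pow, abs_inv,
    abs_of_pos (sqrt_abs_det_pos A), inv_pow, Real.sq_sqrt h.le, inv_mul_cancel₀ h.ne']

theorem val_eq_smul_normalize (A : GL (Fin 2) ℝ) : (A : Matrix (Fin 2) (Fin 2) ℝ) =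
    √|(A : Matrix (Fin 2) (Fin 2) ℝ).det| • normalize A := by
  rw [normalize_apply, smul_smul, mul_inv_cancel₀ (sqrt_abs_det_pos A).ne', one_smul]

theorem opNorm_eq (A : GL (Fin 2) ℝ) :
    opNorm A = √|(A : Matrix (Fin 2) (Fin 2) ℝ).det| * ‖normalize A‖ := by
  have : opNorm A = ‖(A : Matrix (Fin 2) (Fin 2) ℝ)‖ := rfl
  rw [this]
  conv_lhs => rw [val_eq_smul_normalize A, norm_smul, Real.norm_of_nonneg (Real.sqrt_nonneg _)]

theorem abs_det_div_opNorm_sq (A : GL (Fin 2) ℝ) :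
    |(A : Matrix (Fin 2) (Fin 2) ℝ).det| / opNorm A ^ 2 = (‖normalize A‖ ^ 2)⁻¹ := by
  have h := abs_pos.2 (det_ne_zero A)
  rw [opNorm_eq, mul_pow, Real.sq_sqrt h.le, div_mul_eq_div_div, div_self h.ne', one_div]

theorem one_le_norm_normalize (A : GL (Fin 2) ℝ) : 1 ≤ ‖normalize A‖ :=
  one_le_norm (abs_det_normalize A)

theorem norm_normalize_mul_le (A B : GL (Fin 2) ℝ) :
    ‖normalize (A * B)‖ ≤ ‖normalize A‖ * ‖normalize B‖ := by
  rw [map_mul]; exact norm_mul_le _ _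

theorem continuous_normalize : Continuous normalize := by
  have h : Continuous fun A : GL (Fin 2) ℝ => (A : Matrix (Fin 2) (Fin 2) ℝ) :=
    Units.continuous_val
  change Continuous fun A : GL (Fin 2) ℝ =>
    (√|(A : Matrix (Fin 2) (Fin 2) ℝ).det|)⁻¹ • (A : Matrix (Fin 2) (Fin 2) ℝ)
  exact ((h.matrix_det.abs.sqrt).inv₀ fun A => (sqrt_abs_det_pos A).ne').smul h

theorem normalize_mulVec_inv (A : GL (Fin 2) ℝ) (v : Fin 2 → ℝ) :
    (normalize A).mulVec ((normalize A⁻¹).mulVec v) = v := by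
  rw [Matrix.mulVec_mulVec, ← map_mul, mul_inv_cancel, map_one, Matrix.one_mulVec]

theorem normalize_inv_mulVec (A : GL (Fin 2) ℝ) (v : Fin 2 → ℝ) :
    (normalize A⁻¹).mulVec ((normalize A).mulVec v) = v := by
  rw [Matrix.mulVec_mulVec, ← map_mul, inv_mul_cancel, map_one, Matrix.one_mulVec]

/-- In the plane, a matrix of determinant `±1` and its inverse have the same norm. -/
theorem norm_normalize_inv (A : GL (Fin 2) ℝ) : ‖normalize A⁻¹‖ = ‖normalize A‖ := by
  have key : ∀ B : GL (Fin 2) ℝ, ‖normalize B⁻¹‖ ≤ ‖normalize B‖ := fun B => by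
    refine norm_le_of_vnorm_mulVec_le (norm_nonneg _) fun v => ?_
    have := vnorm_le_norm_mul_vnorm_mulVec (abs_det_normalize B) ((normalize B⁻¹).mulVec v)
    rwa [normalize_mulVec_inv] at this
  exact le_antisymm (key A) (by simpa using key A⁻¹)

theorem norm_normalize_le_mul (A B : GL (Fin 2) ℝ) :
    ‖normalize B‖ ≤ ‖normalize A‖ * ‖normalize (A * B)‖ := by
  have := norm_normalize_mul_le A⁻¹ (A * B)
  rwa [inv_mul_cancel_left, norm_normalize_inv] at this

/-- Domination in terms of normalized matrices. -/
theorem isDominated_iff {𝒜 : Set (GL (Fin 2) ℝ)} : IsDominated 𝒜 ↔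
    ∃ c τ : ℝ, 0 < c ∧ 0 < τ ∧ τ < 1 ∧ ∀ l : List (GL (Fin 2) ℝ), l ≠ [] → (∀ A ∈ l, A ∈ 𝒜) →
      (‖normalize l.prod‖ ^ 2)⁻¹ ≤ c * τ ^ l.length := by
  simp only [IsDominated, abs_det_div_opNorm_sq]

/-- Almost multiplicativity in terms of normalized matrices; the identity may be added to the
semigroup, and the constant taken at most `1`. -/
theorem isAlmostMultiplicative_iff {S : Subsemigroup (GL (Fin 2) ℝ)} :
    IsAlmostMultiplicative S ↔ ∃ κ : ℝ, 0 < κ ∧ κ ≤ 1 ∧ ∀ A B, (A ∈ S ∨ A = 1) → (B ∈ S ∨ B = 1) →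
      κ * ‖normalize A‖ * ‖normalize B‖ ≤ ‖normalize (A * B)‖ := by
  have key : ∀ (κ : ℝ) (A B : GL (Fin 2) ℝ), κ * opNorm A * opNorm B ≤ opNorm (A * B) ↔
      κ * ‖normalize A‖ * ‖normalize B‖ ≤ ‖normalize (A * B)‖ := fun κ A B => by
    have h1 := sqrt_abs_det_pos A
    have h2 := sqrt_abs_det_pos B
    simp only [opNorm_eq, Units.val_mul, Matrix.det_mul, abs_mul, Real.sqrt_mul (abs_nonneg _)]
    rw [← mul_le_mul_iff_right₀ (mul_pos h1 h2)
      (b := κ * ‖normalize A‖ * ‖normalize B‖)]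
    exact iff_of_eq (congrArg₂ _ (by ring) rfl)
  simp only [IsAlmostMultiplicative, key]
  constructor
  · rintro ⟨κ, hκ, h⟩
    refine ⟨min κ 1, lt_min hκ one_pos, min_le_right _ _, ?_⟩
    rintro A B (hA | rfl) (hB | rfl)
    · refine le_trans ?_ (h A hA B hB)
      gcongr
      exact min_le_left _ _
    · simpa [norm_one_matrix] using
        mul_le_of_le_one_left (norm_nonneg _) (min_le_right κ 1)
    · simpa [norm_one_matrix] using
        mul_le_of_le_one_left (norm_nonneg _) (min_le_right κ 1)
    · simp
  · rintro ⟨κ, hκ, -, h⟩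
    exact ⟨κ, hκ, fun A hA B hB => h A B (.inl hA) (.inl hB)⟩

theorem list_prod_mem_closure {𝒜 : Set (GL (Fin 2) ℝ)} {l : List (GL (Fin 2) ℝ)}
    (h : ∀ A ∈ l, A ∈ 𝒜) : l.prod ∈ Subsemigroup.closure 𝒜 ∨ l.prod = 1 := by
  induction l with
  | nil => exact .inr rfl
  | cons a l ih =>
    have ha : a ∈ Subsemigroup.closure 𝒜 := Subsemigroup.subset_closure (h a (by simp))
    rw [List.prod_cons]
    rcases ih fun A hA => h A (by simp [hA]) with h1 | h1
    · exact .inl (mul_mem ha h1)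
    · rw [h1, mul_one]; exact .inl ha

theorem exists_list_of_mem_closure {𝒜 : Set (GL (Fin 2) ℝ)} {A : GL (Fin 2) ℝ}
    (h : A ∈ Subsemigroup.closure 𝒜) :
    ∃ l : List (GL (Fin 2) ℝ), l ≠ [] ∧ (∀ B ∈ l, B ∈ 𝒜) ∧ l.prod = A := by
  induction h using Subsemigroup.closure_induction with
  | mem x hx => exact ⟨[x], by simp, by simpa using hx, by simp⟩
  | mul x y _ _ hx hy =>
    obtain ⟨l, hl, hl', rfl⟩ := hx
    obtain ⟨m, hm, hm', rfl⟩ := hy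
    refine ⟨l ++ m, by simp [hl], fun B hB => ?_, by simp⟩
    rcases List.mem_append.1 hB with h | h
    exacts [hl' B h, hm' B h]

/-! ### Norms along an orbit -/

/-- The coefficient of `v` in the orthogonal decomposition of `w` along `v`. -/
def slope (v w : Fin 2 → ℝ) : ℝ := (v 0 * w 0 + v 1 * w 1) / vnorm v ^ 2

theorem slope_add_right (v w z : Fin 2 → ℝ) : slope v (w + z) = slope v w + slope v z := by
  simp only [slope, Pi.add_apply]; ring

theorem slope_smul_right (c : ℝ) (v w : Fin 2 → ℝ) : slope v (c • w) = c * slope v w := by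
  simp only [slope, Pi.smul_apply, smul_eq_mul]; ring

theorem slope_self {v : Fin 2 → ℝ} (hv : v ≠ 0) : slope v v = 1 := by
  have h := vnorm_pos.2 hv
  rw [slope, div_eq_one_iff_eq (by positivity), vnorm_sq]; ring

theorem abs_slope_mul_le (v w : Fin 2 → ℝ) : |slope v w| * vnorm v ≤ vnorm w := by
  by_cases hv : v = 0
  · simp [hv, vnorm_eq_zero.2, vnorm_nonneg]
  have h := vnorm_pos.2 hv
  rw [slope, abs_div, abs_of_pos (pow_pos h 2), div_mul_eq_mul_div, div_le_iff₀ (by positivity)]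
  nlinarith [abs_dot_le v w, mul_le_mul_of_nonneg_right (abs_dot_le v w) h.le]

theorem vnorm_le_slope_add_area {v : Fin 2 → ℝ} (hv : v ≠ 0) (w : Fin 2 → ℝ) :
    vnorm w ≤ |slope v w| * vnorm v + |area v w| / vnorm v := by
  have h := vnorm_pos.2 hv
  have h1 := vnorm_add_le (slope v w • v) ((area v w / vnorm v ^ 2) • rot v)
  rw [slope, ← eq_smul_add_rot hv w, vnorm_smul, vnorm_smul, vnorm_rot, abs_div (area v w),
    abs_of_pos (pow_pos h 2)] at h1
  refine h1.trans (le_of_eq ?_)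
  rw [slope]
  field_simp

/-- Applying a matrix changes the slope in an orbit frame by a controlled amount. -/
theorem abs_slope_mulVec_le {A : Matrix (Fin 2) (Fin 2) ℝ} (hA : |A.det| = 1)
    {v : Fin 2 → ℝ} (hv : v ≠ 0) (w : Fin 2 → ℝ) :
    |slope (A.mulVec v) (A.mulVec w)| ≤
      |slope v w| + |area v w| * ‖A‖ ^ 2 * (vnorm v ^ 2)⁻¹ := by
  have h := vnorm_pos.2 hv
  have hAv := vnorm_pos.2 (mulVec_ne_zero hA hv)
  have e : slope (A.mulVec v) (A.mulVec w) =
      slope v w + area v w / vnorm v ^ 2 * slope (A.mulVec v) (A.mulVec (rot v)) := by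
    conv_lhs => rw [eq_smul_add_rot hv w, Matrix.mulVec_add, Matrix.mulVec_smul,
      Matrix.mulVec_smul, slope_add_right, slope_smul_right, slope_smul_right,
      slope_self (mulVec_ne_zero hA hv), mul_one]
    rfl
  rw [e]
  refine (abs_add_le _ _).trans (add_le_add_right ?_ _)
  rw [abs_mul, abs_div, abs_of_pos (pow_pos h 2), div_mul_eq_mul_div, div_eq_mul_inv]
  refine mul_le_mul_of_nonneg_right (mul_le_mul_of_nonneg_left ?_ (abs_nonneg _)) (by positivity)
  have h1 := abs_slope_mul_le (A.mulVec v) (A.mulVec (rot v))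
  have h2 := vnorm_mulVec_le A (rot v)
  rw [vnorm_rot] at h2
  have h3 := mul_le_mul_of_nonneg_left (vnorm_le_norm_mul_vnorm_mulVec hA v) (norm_nonneg A)
  refine le_of_mul_le_mul_right ?_ hAv
  nlinarith

/-- The product `X (i + n - 1) ⋯ X i`. -/
def stepProd (X : ℕ → Matrix (Fin 2) (Fin 2) ℝ) (i : ℕ) : ℕ → Matrix (Fin 2) (Fin 2) ℝ
  | 0 => 1
  | n + 1 => X (i + n) * stepProd X i n

/-- Along an orbit `v k` of a sequence of matrices of determinant `±1`, the matrices are, in the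
frames adapted to `v k`, triangular with diagonal entries `vnorm (v (k + 1)) / vnorm (v k)` and
its inverse; this bounds the norm of their products. -/
theorem norm_stepProd_le {X : ℕ → Matrix (Fin 2) (Fin 2) ℝ} (hdet : ∀ k, |(X k).det| = 1) {M : ℝ}
    (hM : ∀ k, ‖X k‖ ≤ M) {v : ℕ → Fin 2 → ℝ} (hv : ∀ k, v k ≠ 0)
    (hXv : ∀ k, v (k + 1) = (X k).mulVec (v k)) (i n : ℕ) :
    ‖stepProd X i n‖ ≤ (M ^ 2 + 2) * (vnorm (v i) * vnorm (v (i + n)) *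
      ∑ k ∈ Finset.range (n + 1), (vnorm (v (i + k)) ^ 2)⁻¹) := by
  have hpos : ∀ k, 0 < vnorm (v k) := fun k => vnorm_pos.2 (hv k)
  set σ : ℕ → ℝ := fun n => ∑ k ∈ Finset.range n, (vnorm (v (i + k)) ^ 2)⁻¹ with hσ
  have hσ0 : ∀ n, 0 ≤ σ n := fun n => Finset.sum_nonneg fun k _ => by positivity
  have hσi : (vnorm (v i) ^ 2)⁻¹ ≤ σ (n + 1) := by
    have := Finset.single_le_sum (f := fun k => (vnorm (v (i + k)) ^ 2)⁻¹)
      (fun k _ => by positivity) (Finset.mem_range.2 (Nat.succ_pos n))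
    simpa using this
  have hσs : σ (n + 1) = σ n + (vnorm (v (i + n)) ^ 2)⁻¹ := Finset.sum_range_succ _ _
  refine norm_le_of_vnorm_mulVec_le (mul_nonneg (by positivity)
    (mul_nonneg (mul_nonneg (hpos i).le (hpos (i + n)).le) (hσ0 (n + 1)))) fun y => ?_
  have hy : ∀ n, |area (v (i + n)) ((stepProd X i n).mulVec y)| = |area (v i) y| ∧
      |slope (v (i + n)) ((stepProd X i n).mulVec y)| ≤
        |slope (v i) y| + |area (v i) y| * M ^ 2 * σ n := by
    intro n
    induction n with
    | zero => simp [stepProd, hσ]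
    | succ n ih =>
      rw [stepProd, ← Matrix.mulVec_mulVec, ← add_assoc, hXv]
      refine ⟨(abs_area_mulVec (hdet _) _ _).trans ih.1, ?_⟩
      refine (abs_slope_mulVec_le (hdet _) (hv _) _).trans ?_
      rw [ih.1, show σ (n + 1) = σ n + (vnorm (v (i + n)) ^ 2)⁻¹ from Finset.sum_range_succ _ _]
      have h2 : ‖X (i + n)‖ ^ 2 ≤ M ^ 2 := pow_le_pow_left₀ (norm_nonneg _) (hM _) 2
      have h3 : |area (v i) y| * ‖X (i + n)‖ ^ 2 * (vnorm (v (i + n)) ^ 2)⁻¹ ≤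
          |area (v i) y| * M ^ 2 * (vnorm (v (i + n)) ^ 2)⁻¹ := by gcongr
      linarith [ih.2]
  obtain ⟨h1, h2⟩ := hy n
  have h3 := vnorm_le_slope_add_area (hv (i + n)) ((stepProd X i n).mulVec y)
  rw [h1] at h3
  have h4 : |slope (v i) y| ≤ vnorm (v i) * (vnorm (v i) ^ 2)⁻¹ * vnorm y := by
    have := abs_slope_mul_le (v i) y
    have e : vnorm (v i) * (vnorm (v i) ^ 2)⁻¹ * vnorm y = vnorm y / vnorm (v i) := by
      field_simp
    rw [e, le_div_iff₀ (hpos i)]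
    exact this
  have h5 := abs_area_le (v i) y
  have h6 : |area (v i) y| / vnorm (v (i + n)) ≤
      vnorm (v i) * vnorm (v (i + n)) * (vnorm (v (i + n)) ^ 2)⁻¹ * vnorm y := by
    have e : vnorm (v i) * vnorm (v (i + n)) * (vnorm (v (i + n)) ^ 2)⁻¹ * vnorm y =
      (vnorm (v i) * vnorm y) / vnorm (v (i + n)) := by
      have := (hpos (i + n)).ne'
      field_simp
    rw [e]
    exact div_le_div_of_nonneg_right h5 (hpos _).le
  have h7 : |slope (v (i + n)) ((stepProd X i n).mulVec y)| * vnorm (v (i + n)) ≤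
      (vnorm (v i) * (vnorm (v i) ^ 2)⁻¹ * vnorm y + vnorm (v i) * vnorm y * M ^ 2 * σ n) *
        vnorm (v (i + n)) := by
    refine mul_le_mul_of_nonneg_right (h2.trans (add_le_add h4 ?_)) (hpos _).le
    have := hσ0 n
    gcongr
  have h8 : σ n ≤ σ (n + 1) := by
    rw [hσs]
    have := hpos (i + n)
    linarith [show 0 < (vnorm (v (i + n)) ^ 2)⁻¹ by positivity]
  have h9 : (vnorm (v (i + n)) ^ 2)⁻¹ ≤ σ (n + 1) := by rw [hσs]; linarith [hσ0 n]
  have h10 : (vnorm (v i) ^ 2)⁻¹ + M ^ 2 * σ n + (vnorm (v (i + n)) ^ 2)⁻¹ ≤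
      (M ^ 2 + 2) * σ (n + 1) := by
    nlinarith [mul_le_mul_of_nonneg_left h8 (sq_nonneg M)]
  have h11 := mul_le_mul_of_nonneg_left h10
    (mul_nonneg (mul_nonneg (hpos i).le (hpos (i + n)).le) (vnorm_nonneg y))
  linarith

/-! ### Sequences without interior near-maxima -/

/-- If the sums of `(f k ^ 2)⁻¹` grow as for an orbit of a dominated family, then `f` cannot have an
interior time from which it drops by a definite factor both in the past and in the future. -/
theorem exists_dichotomy {M a Λ : ℝ} (hM : 1 ≤ M) (ha : 0 < a) (hΛ : 1 < Λ) :
    ∃ η : ℝ, 0 < η ∧ η ≤ 1 ∧ ∀ f : ℕ → ℝ, (∀ k, 0 < f k) → (∀ k, f (k + 1) ≤ M * f k) →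
      (∀ k, f k ≤ M * f (k + 1)) →
      (∀ i n, a * Λ ^ n ≤ f i * f (i + n) * ∑ k ∈ Finset.range (n + 1), (f (i + k) ^ 2)⁻¹) →
      ∀ i j k, i ≤ j → j ≤ k → η * f j ≤ f i ∨ η * f j ≤ f k := by
  obtain ⟨N, hN⟩ : ∃ N : ℕ, ∀ n ≥ N, M ^ 2 * (n + 1) < a * Λ ^ n := by
    have h1 : Tendsto (fun n : ℕ => (n : ℝ) ^ 1 / Λ ^ n) atTop (𝓝 0) :=
      tendsto_pow_const_div_const_pow_of_one_lt 1 hΛ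
    have h2 : Tendsto (fun n : ℕ => 1 / Λ ^ n) atTop (𝓝 0) := by
      simpa using tendsto_pow_const_div_const_pow_of_one_lt 0 hΛ
    have h3 : Tendsto (fun n : ℕ => M ^ 2 * ((n : ℝ) ^ 1 / Λ ^ n + 1 / Λ ^ n)) atTop (𝓝 0) := by
      simpa using (h1.add h2).const_mul (M ^ 2)
    obtain ⟨N, hN⟩ := eventually_atTop.1 (h3.eventually_lt_const ha)
    refine ⟨N, fun n hn => ?_⟩
    have hp : 0 < Λ ^ n := by positivity
    have := hN n hn
    rw [pow_one, ← add_div, ← mul_div_assoc, div_lt_iff₀ hp] at this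
    exact this
  have hM0 : 0 < M := by linarith
  have hη1 : (M ^ N)⁻¹ ≤ 1 := inv_le_one_of_one_le₀ (one_le_pow₀ hM)
  refine ⟨(M ^ N)⁻¹, by positivity, hη1, fun f hf hf1 hf2 hsum i j k hij hjk => ?_⟩
  set η := (M ^ N)⁻¹ with hη
  have hη0 : 0 < η := by positivity
  by_contra! hcon
  -- the last time `i'` before `j` and the first time `k'` after `j` below the threshold
  classical
  set i' := Nat.findGreatest (fun m => f m < η * f j) j with hi'
  have hi1 : f i' < η * f j := Nat.findGreatest_spec (P := fun m => f m < η * f j) hij hcon.1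
  have hi2 : i' ≤ j := Nat.findGreatest_le j
  have hi3 : ∀ m, i' < m → m ≤ j → η * f j ≤ f m := fun m h1 h2 =>
    not_lt.1 (Nat.findGreatest_is_greatest (P := fun m => f m < η * f j) h1 h2)
  have hex : ∃ m, j ≤ m ∧ f m < η * f j := ⟨k, hjk, hcon.2⟩
  set k' := Nat.find hex with hk'
  obtain ⟨hk2, hk1⟩ : j ≤ k' ∧ f k' < η * f j := Nat.find_spec hex
  have hk3 : ∀ m, j ≤ m → m < k' → η * f j ≤ f m := fun m h1 h2 => by
    have := Nat.find_min hex h2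
    push Not at this
    exact this h1
  have hj : η * f j ≤ f j := mul_le_of_le_one_left (hf j).le hη1
  have hji : i' ≠ j := fun h => by rw [h] at hi1; linarith
  have hjk' : k' ≠ j := fun h => by rw [h] at hk1; linarith
  have hmid : ∀ m, i' < m → m < k' → η * f j ≤ f m := fun m h1 h2 => by
    rcases le_total m j with h | h
    exacts [hi3 m h1 h, hk3 m h h2]
  have hall : ∀ m, i' ≤ m → m ≤ k' → η * f j ≤ M * f m := fun m h1 h2 => by
    rcases h1.eq_or_lt with h | h
    · rw [← h]
      exact (hmid (i' + 1) (by omega) (by omega)).trans (hf1 i')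
    rcases h2.eq_or_lt with h' | h'
    · have e : m = (m - 1) + 1 := by omega
      rw [e]
      exact (hmid (m - 1) (by omega) (by omega)).trans (hf2 (m - 1))
    · exact (hmid m h h').trans (le_mul_of_one_le_left (hf m).le hM)
  obtain ⟨n, hn⟩ : ∃ n, k' = i' + n := ⟨k' - i', by omega⟩
  set t := η * f j with ht
  have ht0 : 0 < t := mul_pos hη0 (hf j)
  have h1 : ∑ m ∈ Finset.range (n + 1), (f (i' + m) ^ 2)⁻¹ ≤ (n + 1) * (M ^ 2 * (t ^ 2)⁻¹) := by
    have := Finset.sum_le_card_nsmul (Finset.range (n + 1)) (fun m => (f (i' + m) ^ 2)⁻¹)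
      (M ^ 2 * (t ^ 2)⁻¹) fun m hm => by
        have hm' := Finset.mem_range.1 hm
        have h2 := hall (i' + m) (by omega) (by omega)
        have h3 := pow_le_pow_left₀ ht0.le h2 2
        have h4 := hf (i' + m)
        change (f (i' + m) ^ 2)⁻¹ ≤ M ^ 2 * (t ^ 2)⁻¹
        rw [inv_le_iff_one_le_mul₀ (by positivity), mul_assoc, inv_mul_eq_div, ← mul_div_assoc,
          one_le_div₀ (by positivity), ← mul_pow]
        exact h3
    simpa using this
  have h2 : f i' * f (i' + n) ≤ t ^ 2 := by
    rw [← hn, sq]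
    exact mul_le_mul hi1.le hk1.le (hf _).le ht0.le
  have h3 : a * Λ ^ n ≤ M ^ 2 * (n + 1) := by
    refine (hsum i' n).trans ((mul_le_mul h2 h1 (Finset.sum_nonneg fun m _ => ?_)
      (by positivity)).trans (le_of_eq ?_))
    · have := hf (i' + m); positivity
    · field_simp
  have h4 : n < N := by
    by_contra h
    exact (hN n (not_lt.1 h)).not_ge h3
  have h5 : ∀ m, f (i' + m) ≤ M ^ m * f i' := fun m => by
    induction m with
    | zero => simp
    | succ m ih =>
      rw [← add_assoc, pow_succ']
      have := (hf1 (i' + m)).trans (mul_le_mul_of_nonneg_left ih hM0.le)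
      linarith
  have h6 := h5 (j - i')
  rw [show i' + (j - i') = j by omega] at h6
  have h7 : M ^ (j - i') ≤ M ^ N := pow_le_pow_right₀ hM (by omega)
  have h8 : M ^ N * η = 1 := mul_inv_cancel₀ (by positivity)
  have h9 : f j ≤ M ^ N * f i' := h6.trans (mul_le_mul_of_nonneg_right h7 (hf _).le)
  have h10 : M ^ N * f i' < M ^ N * t := mul_lt_mul_of_pos_left hi1 (by positivity)
  have h11 : M ^ N * t = f j := by rw [ht, ← mul_assoc, h8, one_mul]
  linarith

/-- If moreover `f` has dropped a lot at a time `L ≥ n`, then before time `n` it decays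
exponentially fast, so that the sum up to time `n` is comparable to its last term. -/
theorem exists_sum_le {M a Λ : ℝ} (hM : 1 ≤ M) (ha : 0 < a) (hΛ : 1 < Λ) :
    ∃ δ C : ℝ, 0 < δ ∧ 0 < C ∧ ∀ f : ℕ → ℝ, (∀ k, 0 < f k) → (∀ k, f (k + 1) ≤ M * f k) →
      (∀ k, f k ≤ M * f (k + 1)) →
      (∀ i n, a * Λ ^ n ≤ f i * f (i + n) * ∑ k ∈ Finset.range (n + 1), (f (i + k) ^ 2)⁻¹) →
      ∀ n L, n ≤ L → f L < δ * f n →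
        f n ^ 2 * ∑ k ∈ Finset.range (n + 1), (f k ^ 2)⁻¹ ≤ C := by
  obtain ⟨η, hη0, hη1, hη⟩ := exists_dichotomy hM ha hΛ
  set F : ℕ → ℝ := fun m => ((m + 1) / (a * η ^ 2 * Λ ^ m)) ^ 2 with hF
  have hF0 : ∀ m, 0 ≤ F m := fun m => sq_nonneg _
  have hFs : Summable F := by
    have hΛ2 : ‖(Λ⁻¹ ^ 2 : ℝ)‖ < 1 := by
      have h1 : Λ⁻¹ < 1 := inv_lt_one_of_one_lt₀ hΛ
      have h0 : 0 < Λ⁻¹ := by positivity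
      rw [Real.norm_of_nonneg (by positivity)]
      exact pow_lt_one₀ h0.le h1 two_ne_zero
    have s2 := summable_pow_mul_geometric_of_norm_lt_one 2 hΛ2
    have s1 := summable_pow_mul_geometric_of_norm_lt_one 1 hΛ2
    have s0 := summable_pow_mul_geometric_of_norm_lt_one 0 hΛ2
    refine ((((s2.add (s1.mul_left 2)).add s0).mul_left ((a * η ^ 2) ^ 2)⁻¹)).congr fun m => ?_
    have h0 : Λ ≠ 0 := by positivity
    simp only [hF, pow_zero, pow_one, inv_pow, ← pow_mul]
    rw [div_pow, mul_pow _ (Λ ^ m), ← pow_mul Λ, mul_comm m 2]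
    field_simp
    ring
  refine ⟨η, ∑' m, F m + 1, hη0,
    add_pos_of_nonneg_of_pos (tsum_nonneg hF0) one_pos, fun f hf hf1 hf2 hsum n L hnL hL => ?_⟩
  have hdich := hη f hf hf1 hf2 hsum
  have h1 : ∀ i ≤ n, η * f n ≤ f i := fun i hi =>
    (hdich i n L hi hnL).resolve_right hL.not_ge
  have h3 : ∀ i ≤ n, f n ^ 2 * (f i ^ 2)⁻¹ ≤ F (n - i) := fun i hi => by
    obtain ⟨m, rfl⟩ := Nat.exists_eq_add_of_le hi
    rw [Nat.add_sub_cancel_left]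
    have hn0 := hf (i + m)
    have hi0 := hf i
    have h4 : ∑ k ∈ Finset.range (m + 1), (f (i + k) ^ 2)⁻¹ ≤
        (m + 1) * ((η * f (i + m)) ^ 2)⁻¹ := by
      have := Finset.sum_le_card_nsmul (Finset.range (m + 1)) (fun k => (f (i + k) ^ 2)⁻¹)
        (((η * f (i + m)) ^ 2)⁻¹) fun k hk => by
          have hk' := Finset.mem_range.1 hk
          have := h1 (i + k) (by omega)
          have h0 : 0 < η * f (i + m) := mul_pos hη0 hn0
          change (f (i + k) ^ 2)⁻¹ ≤ ((η * f (i + m)) ^ 2)⁻¹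
          gcongr
      simpa using this
    have h5 := (hsum i m).trans (mul_le_mul_of_nonneg_left h4 (mul_pos hi0 hn0).le)
    have h6 : f (i + m) / f i ≤ (m + 1) / (a * η ^ 2 * Λ ^ m) := by
      rw [div_le_div_iff₀ hi0 (by positivity)]
      have e : f i * f (i + m) * ((m + 1) * ((η * f (i + m)) ^ 2)⁻¹) =
          ((m + 1) * f i) / (η ^ 2 * f (i + m)) := by field_simp
      rw [e, le_div_iff₀ (by positivity)] at h5
      linarith
    have h7 := pow_le_pow_left₀ (by positivity) h6 2
    rw [div_pow, div_eq_mul_inv] at h7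
    exact h7
  rw [Finset.mul_sum]
  calc ∑ i ∈ Finset.range (n + 1), f n ^ 2 * (f i ^ 2)⁻¹
      ≤ ∑ i ∈ Finset.range (n + 1), F (n - i) :=
        Finset.sum_le_sum fun i hi => h3 i (by have := Finset.mem_range.1 hi; omega)
    _ = ∑ i ∈ Finset.range (n + 1), F i := Finset.sum_range_reflect F (n + 1)
    _ ≤ ∑' m, F m := hFs.sum_le_tsum _ fun m _ => hF0 m
    _ ≤ _ := by linarith

/-! ### Dominated sets generate almost multiplicative semigroups -/

theorem exists_norm_normalize_le {𝒜 : Set (GL (Fin 2) ℝ)} (h𝒜 : IsCompact 𝒜) :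
    ∃ M : ℝ, 1 ≤ M ∧ ∀ A ∈ 𝒜, ‖normalize A‖ ≤ M := by
  obtain ⟨M, hM⟩ := (h𝒜.image continuous_normalize.norm).bddAbove
  exact ⟨max M 1, le_max_right _ _, fun A hA =>
    (hM (Set.mem_image_of_mem _ hA)).trans (le_max_left _ _)⟩

theorem IsDominated.exists_growth {𝒜 : Set (GL (Fin 2) ℝ)} (h : IsDominated 𝒜) :
    ∃ a Λ : ℝ, 0 < a ∧ 1 < Λ ∧ ∀ l : List (GL (Fin 2) ℝ), (∀ A ∈ l, A ∈ 𝒜) →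
      a * Λ ^ l.length ≤ ‖normalize l.prod‖ := by
  obtain ⟨c, τ, hc, hτ0, hτ1, h⟩ := isDominated_iff.1 h
  refine ⟨min 1 (√c⁻¹), √τ⁻¹, by positivity, ?_, fun l hl => ?_⟩
  · rw [Real.lt_sqrt zero_le_one, one_pow]
    exact (one_lt_inv₀ hτ0).2 hτ1
  · by_cases hnil : l = []
    · simp [hnil]
    have h0 := one_le_norm_normalize l.prod
    have h1 := h l hnil hl
    have h2 : c⁻¹ * τ⁻¹ ^ l.length ≤ ‖normalize l.prod‖ ^ 2 := by
      rw [inv_pow, ← mul_inv]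
      exact inv_le_of_inv_le₀ (by positivity) h1
    refine (mul_le_mul_of_nonneg_right (min_le_right _ _) (by positivity)).trans ?_
    refine le_of_sq_le_sq ?_ (by positivity)
    rwa [mul_pow, ← pow_mul, mul_comm _ 2, pow_mul, Real.sq_sqrt (by positivity),
      Real.sq_sqrt (by positivity)]

theorem stepProd_add (X : ℕ → Matrix (Fin 2) (Fin 2) ℝ) (i m n : ℕ) :
    stepProd X i (m + n) = stepProd X (i + m) n * stepProd X i m := by
  induction n with
  | zero => simp [stepProd]
  | succ n ih => rw [← add_assoc, stepProd, ih, stepProd, mul_assoc, add_assoc]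

theorem stepProd_normalize (Y : ℕ → GL (Fin 2) ℝ) (i n : ℕ) :
    stepProd (fun k => normalize (Y k)) i n =
      normalize (((List.range n).map fun k => Y (i + k)).reverse.prod) := by
  induction n with
  | zero => simp [stepProd]
  | succ n ih => simp [stepProd, ih, List.range_succ]

theorem map_range_getD {α : Type*} (l m : List α) (d : α) :
    ((List.range l.length).map fun k => (l ++ m).getD k d) = l := by
  refine List.ext_getElem (by simp) fun k h1 h2 => ?_
  simp [List.getElem?_append_left h2, h2]

theorem map_range_getD_add {α : Type*} (l m : List α) (d : α) :
    ((List.range m.length).map fun k => (l ++ m).getD (l.length + k) d) = m := by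
  refine List.ext_getElem (by simp) fun k h1 h2 => ?_
  simp [h2]

theorem IsDominated.isAlmostMultiplicative {𝒜 : Set (GL (Fin 2) ℝ)} (h𝒜 : IsCompact 𝒜)
    (h : IsDominated 𝒜) : IsAlmostMultiplicative (Subsemigroup.closure 𝒜) := by
  obtain ⟨M, hM1, hM⟩ := exists_norm_normalize_le h𝒜
  obtain ⟨a, Λ, ha, hΛ, hgrow⟩ := h.exists_growth
  have hM2 : 0 < M ^ 2 + 2 := by positivity
  obtain ⟨δ, C, hδ, hC, hsum⟩ :=
    exists_sum_le hM1 (a := a / (M ^ 2 + 2)) (by positivity) hΛ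
  set C' := (M ^ 2 + 2) * C with hC'
  have hC'0 : 0 < C' := by positivity
  refine isAlmostMultiplicative_iff.2 ⟨min (min 1 ((δ / 2) ^ 2)) (1 / (2 * C')), by positivity,
    (min_le_left _ _).trans (min_le_left _ _), fun A B hA hB => ?_⟩
  have hnA := one_le_norm_normalize A
  have hnB := one_le_norm_normalize B
  rcases hA with hA | rfl
  swap
  · rw [one_mul]
    simpa [norm_one_matrix] using mul_le_of_le_one_left (norm_nonneg (normalize B))
      ((min_le_left _ (1 / (2 * C'))).trans (min_le_left 1 ((δ / 2) ^ 2)))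
  rcases hB with hB | rfl
  swap
  · rw [mul_one]
    simpa [norm_one_matrix] using mul_le_of_le_one_left (norm_nonneg (normalize A))
      ((min_le_left _ (1 / (2 * C'))).trans (min_le_left 1 ((δ / 2) ^ 2)))
  rcases le_or_gt ‖normalize A‖ (2 / δ) with hsmall | hlarge
  · -- if `A` has bounded norm, it cannot shrink `B` by more than a bounded factor
    have h1 := norm_normalize_le_mul A B
    have h2 : δ / 2 * ‖normalize A‖ ≤ 1 := by
      rw [le_div_iff₀ hδ] at hsmall; linarith
    have h3 : (δ / 2) ^ 2 * ‖normalize A‖ * ‖normalize B‖ ≤ ‖normalize (A * B)‖ := by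
      calc (δ / 2) ^ 2 * ‖normalize A‖ * ‖normalize B‖
          ≤ (δ / 2) ^ 2 * ‖normalize A‖ * (‖normalize A‖ * ‖normalize (A * B)‖) := by gcongr
        _ = (δ / 2 * ‖normalize A‖) ^ 2 * ‖normalize (A * B)‖ := by ring
        _ ≤ 1 * ‖normalize (A * B)‖ := by
          gcongr
          exact pow_le_one₀ (by positivity) h2
        _ = _ := one_mul _
    refine le_trans ?_ h3
    gcongr
    exact (min_le_left _ _).trans (min_le_right _ _)
  · obtain ⟨s, hs1, hs2⟩ := exists_contracted (abs_det_normalize A)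
    obtain ⟨lA, hlA0, hlA, rfl⟩ := exists_list_of_mem_closure hA
    obtain ⟨lB, hlB0, hlB, rfl⟩ := exists_list_of_mem_closure hB
    set A := lA.prod
    set B := lB.prod
    obtain ⟨d, hd⟩ := List.exists_mem_of_ne_nil lA hlA0
    -- the letters of `A B` in the order in which they act, continued by a constant letter
    set Y : ℕ → GL (Fin 2) ℝ := fun k => (lB.reverse ++ lA.reverse).getD k d with hY
    have hY𝒜 : ∀ k, Y k ∈ 𝒜 := fun k => by
      simp only [hY, List.getD_eq_getElem?_getD]
      rcases hk : (lB.reverse ++ lA.reverse)[k]? with _ | x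
      · exact hlA d hd
      · have := List.mem_of_getElem? hk
        rcases List.mem_append.1 this with h | h
        exacts [hlB x (List.mem_reverse.1 h), hlA x (List.mem_reverse.1 h)]
    set X : ℕ → Matrix (Fin 2) (Fin 2) ℝ := fun k => normalize (Y k) with hX
    have hXB : stepProd X 0 lB.length = normalize B := by
      have := map_range_getD lB.reverse lA.reverse d
      rw [List.length_reverse] at this
      rw [stepProd_normalize]
      simp only [zero_add, hY, this, List.reverse_reverse, B]
    have hXA : stepProd X lB.length lA.length = normalize A := by
      have := map_range_getD_add lB.reverse lA.reverse d
      rw [List.length_reverse, List.length_reverse] at this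
      rw [stepProd_normalize]
      simp only [hY, this, List.reverse_reverse, A]
    have hXgrow : ∀ i n, a * Λ ^ n ≤ ‖stepProd X i n‖ := fun i n => by
      rw [stepProd_normalize]
      have := hgrow (((List.range n).map fun k => Y (i + k)).reverse) (by
        intro x hx
        obtain ⟨k, -, rfl⟩ := List.mem_map.1 (List.mem_reverse.1 hx)
        exact hY𝒜 _)
      simpa using this
    have hXdet : ∀ k, |(X k).det| = 1 := fun k => abs_det_normalize _
    have hXM : ∀ k, ‖X k‖ ≤ M := fun k => hM _ (hY𝒜 k)
    have hs0 : s ≠ 0 := vnorm_pos.1 (by rw [hs1]; exact one_pos)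
    set w := (normalize B⁻¹).mulVec s with hw
    have hw0 : w ≠ 0 := mulVec_ne_zero (abs_det_normalize _) hs0
    set v : ℕ → Fin 2 → ℝ := fun k => (stepProd X 0 k).mulVec w with hv
    have hv1 : ∀ k, v (k + 1) = (X k).mulVec (v k) := fun k => by
      simp only [hv, stepProd, zero_add, Matrix.mulVec_mulVec]
    have hv0 : v 0 = w := Matrix.one_mulVec w
    have hvne : ∀ k, v k ≠ 0 := fun k => by
      induction k with
      | zero => rwa [hv0]
      | succ k ih => rw [hv1]; exact mulVec_ne_zero (hXdet k) ih
    have hvB : v lB.length = s := by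
      simp only [hv, hXB, hw, normalize_mulVec_inv]
    have hvA : v (lB.length + lA.length) = (normalize A).mulVec s := by
      rw [← hvB]
      simp only [hv, stepProd_add, zero_add, hXA, Matrix.mulVec_mulVec]
    have hle := norm_stepProd_le hXdet hXM hvne hv1
    have hS := hsum (fun k => vnorm (v k)) (fun k => vnorm_pos.2 (hvne k))
      (fun k => by
        rw [hv1]
        exact (vnorm_mulVec_le _ _).trans (mul_le_mul_of_nonneg_right (hXM k) (vnorm_nonneg _)))
      (fun k => by
        rw [hv1]
        exact (vnorm_le_norm_mul_vnorm_mulVec (hXdet k) _).trans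
          (mul_le_mul_of_nonneg_right (hXM k) (vnorm_nonneg _)))
      (fun i n => by
        rw [div_mul_eq_mul_div, div_le_iff₀' hM2]
        exact (hXgrow i n).trans (hle i n))
      lB.length (lB.length + lA.length) (Nat.le_add_right _ _) (by
        simp only [hvA, hvB, hs1, mul_one]
        have : δ * ‖normalize A‖ > 2 := by
          rw [div_lt_iff₀ hδ] at hlarge; linarith
        by_contra hcon
        have := mul_le_mul_of_nonneg_right (not_lt.1 hcon) (norm_nonneg (normalize A))
        linarith)
    -- `s` is not close to the image of the direction most expanded by `B`
    have hBw : ‖normalize B‖ ≤ C' * vnorm w := by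
      have h1 := hle 0 lB.length
      simp only [zero_add, hXB, hv0, hvB, hs1, mul_one] at h1
      simp only [hvB, hs1, one_pow, one_mul] at hS
      refine h1.trans ?_
      rw [hC', mul_assoc, mul_comm C]
      gcongr
      exact vnorm_nonneg _
    have hABw : vnorm w ^ 2 ≤ vnorm ((normalize A).mulVec s) *
        vnorm ((normalize (A * B)).mulVec (rot w)) := by
      have h1 := abs_area_mulVec (abs_det_normalize (A * B)) w (rot w)
      rw [area_rot, abs_of_nonneg (sq_nonneg (vnorm w))] at h1
      rw [← h1]
      have h2 : (normalize (A * B)).mulVec w = (normalize A).mulVec s := by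
        rw [map_mul, ← Matrix.mulVec_mulVec, hw, normalize_mulVec_inv]
      rw [h2]
      exact abs_area_le _ _
    have hwpos := vnorm_pos.2 hw0
    have h2 := vnorm_mulVec_le (normalize (A * B)) (rot w)
    rw [vnorm_rot] at h2
    have h3 : vnorm w ≤ vnorm ((normalize A).mulVec s) * ‖normalize (A * B)‖ := by
      refine le_of_mul_le_mul_right ?_ hwpos
      have := mul_le_mul_of_nonneg_left h2 (vnorm_nonneg ((normalize A).mulVec s))
      linarith
    have h4 : ‖normalize A‖ * vnorm w ≤ 2 * ‖normalize (A * B)‖ := by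
      have h5 := mul_le_mul_of_nonneg_left h3 (norm_nonneg (normalize A))
      have h6 := mul_le_mul_of_nonneg_right hs2 (norm_nonneg (normalize (A * B)))
      linarith
    calc min (min 1 ((δ / 2) ^ 2)) (1 / (2 * C')) * ‖normalize A‖ * ‖normalize B‖
        ≤ 1 / (2 * C') * ‖normalize A‖ * (C' * vnorm w) := by
          gcongr
          exact min_le_right _ _
      _ = (‖normalize A‖ * vnorm w) / 2 := by field_simp
      _ ≤ _ := by linarith

/-! ### Proximality and growth of powers -/

/-- Recurrence: a long enough bounded sequence of matrices has two close terms. -/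
theorem exists_close_pair (R : ℝ) {ε : ℝ} (hε : 0 < ε) :
    ∃ t : ℕ, ∀ T : ℕ → Matrix (Fin 2) (Fin 2) ℝ, (∀ k ≤ t, ‖T k‖ ≤ R) →
      ∃ p q, p < q ∧ q ≤ t ∧ ‖T q - T p‖ < ε := by
  obtain ⟨c, hc, hcov⟩ := Metric.totallyBounded_iff.1
    (isCompact_closedBall (0 : Matrix (Fin 2) (Fin 2) ℝ) R).totallyBounded (ε / 2) (half_pos hε)
  refine ⟨hc.toFinset.card, fun T hT => ?_⟩
  have hmem : ∀ k : ℕ, ∃ y, k ≤ hc.toFinset.card → y ∈ c ∧ dist (T k) y < ε / 2 := fun k => by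
    by_cases hk : k ≤ hc.toFinset.card
    · have := hcov (mem_closedBall_zero_iff.2 (hT k hk))
      obtain ⟨y, hy, hd⟩ := Set.mem_iUnion₂.1 this
      exact ⟨y, fun _ => ⟨hy, hd⟩⟩
    · exact ⟨0, fun h => absurd h hk⟩
  choose y hy using hmem
  obtain ⟨p, hp, q, hq, hpq, hyy⟩ := Finset.exists_ne_map_eq_of_card_lt_of_maps_to
    (s := Finset.range (hc.toFinset.card + 1)) (t := hc.toFinset) (f := y) (by simp)
    (fun k hk => by
      have := Finset.mem_range.1 hk
      simpa using (hy k (by omega)).1)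
  have hp' := Finset.mem_range.1 hp
  have hq' := Finset.mem_range.1 hq
  have hd : dist (T q) (T p) < ε := by
    have h1 := (hy p (by omega)).2
    have h2 := (hy q (by omega)).2
    rw [← hyy] at h2
    linarith [dist_triangle_right (T q) (T p) (y p)]
  rw [dist_eq_norm] at hd
  rcases hpq.lt_or_gt with h | h
  · exact ⟨p, q, h, by omega, hd⟩
  · exact ⟨q, p, h, by omega, by rwa [norm_sub_rev]⟩

theorem pow_mulVec_of_eigen {A : Matrix (Fin 2) (Fin 2) ℝ} {v : Fin 2 → ℝ} {r : ℝ}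
    (h : A.mulVec v = r • v) (n : ℕ) : (A ^ n).mulVec v = r ^ n • v := by
  induction n with
  | zero => simp
  | succ n ih => rw [pow_succ', ← Matrix.mulVec_mulVec, ih, Matrix.mulVec_smul, h, smul_smul,
      ← pow_succ]

theorem abs_eigenvalue_eq_one {A : Matrix (Fin 2) (Fin 2) ℝ} (hA : |A.det| = 1) {R : ℝ}
    (hR : ∀ n : ℕ, ‖A ^ n‖ ≤ R) {v : Fin 2 → ℝ} (hv : v ≠ 0) {r : ℝ}
    (h : A.mulVec v = r • v) : |r| = 1 := by
  have hpos := vnorm_pos.2 hv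
  have hR0 : 0 ≤ R := (norm_nonneg _).trans (hR 0)
  have h1 : ∀ n : ℕ, |r| ^ n ≤ R := fun n => by
    have := vnorm_mulVec_le (A ^ n) v
    rw [pow_mulVec_of_eigen h, vnorm_smul, abs_pow] at this
    exact (le_of_mul_le_mul_right this hpos).trans (hR n)
  have h2 : ∀ n : ℕ, 1 ≤ R * |r| ^ n := fun n => by
    have hdet : |(A ^ n).det| = 1 := by rw [Matrix.det_pow, abs_pow, hA, one_pow]
    have := vnorm_le_norm_mul_vnorm_mulVec hdet v
    rw [pow_mulVec_of_eigen h, vnorm_smul, abs_pow] at this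
    have h3 : 1 ≤ ‖A ^ n‖ * |r| ^ n := by
      refine le_of_mul_le_mul_right ?_ hpos
      linarith
    exact h3.trans (mul_le_mul_of_nonneg_right (hR n) (by positivity))
  refine le_antisymm ?_ ?_
  · by_contra! hlt
    obtain ⟨n, hn⟩ := pow_unbounded_of_one_lt R hlt
    exact (h1 n).not_gt hn
  · by_contra! hlt
    have : Tendsto (fun n : ℕ => R * |r| ^ n) atTop (𝓝 (R * 0)) :=
      (tendsto_pow_atTop_nhds_zero_of_lt_one (abs_nonneg r) hlt).const_mul R
    rw [mul_zero] at this
    exact zero_lt_one.not_ge (ge_of_tendsto' this h2)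

theorem isProximal_iff {A : GL (Fin 2) ℝ} : IsProximal A ↔ ∃ (r s : ℝ) (v w : Fin 2 → ℝ),
    |r| ≠ |s| ∧ v ≠ 0 ∧ w ≠ 0 ∧ (normalize A).mulVec v = r • v ∧
      (normalize A).mulVec w = s • w := by
  have hd := sqrt_abs_det_pos A
  set d := √|(A : Matrix (Fin 2) (Fin 2) ℝ).det| with hd'
  have hAe : (A : Matrix (Fin 2) (Fin 2) ℝ) = d • normalize A := val_eq_smul_normalize A
  have hNe : normalize A = d⁻¹ • (A : Matrix (Fin 2) (Fin 2) ℝ) := rfl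
  constructor
  · rintro ⟨r, s, hrs, hr, hs⟩
    obtain ⟨v, hv⟩ := hr.exists_hasEigenvector
    obtain ⟨w, hw⟩ := hs.exists_hasEigenvector
    refine ⟨d⁻¹ * r, d⁻¹ * s, v, w, ?_, hv.2, hw.2, ?_, ?_⟩
    · rw [abs_mul, abs_mul]
      exact fun h => hrs (mul_left_cancel₀ (abs_ne_zero.2 (inv_ne_zero hd.ne')) h)
    · have := hv.apply_eq_smul
      rw [Matrix.toLin'_apply] at this
      rw [hNe, Matrix.smul_mulVec, this, smul_smul]
    · have := hw.apply_eq_smul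
      rw [Matrix.toLin'_apply] at this
      rw [hNe, Matrix.smul_mulVec, this, smul_smul]
  · rintro ⟨r, s, v, w, hrs, hv, hw, hrv, hsw⟩
    refine ⟨d * r, d * s, ?_, ?_, ?_⟩
    · rw [abs_mul, abs_mul]
      exact fun h => hrs (mul_left_cancel₀ (abs_ne_zero.2 hd.ne') h)
    · refine Module.End.hasEigenvalue_of_hasEigenvector (x := v)
        ⟨Module.End.mem_eigenspace_iff.2 ?_, hv⟩
      rw [Matrix.toLin'_apply, hAe, Matrix.smul_mulVec, hrv, smul_smul]
    · refine Module.End.hasEigenvalue_of_hasEigenvector (x := w)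
        ⟨Module.End.mem_eigenspace_iff.2 ?_, hw⟩
      rw [Matrix.toLin'_apply, hAe, Matrix.smul_mulVec, hsw, smul_smul]

theorem IsProximal.exists_norm_pow_gt {A : GL (Fin 2) ℝ} (h : IsProximal A) (R : ℝ) :
    ∃ n : ℕ, R < ‖normalize A ^ n‖ := by
  by_contra! hcon
  obtain ⟨r, s, v, w, hrs, hv, hw, hrv, hsw⟩ := isProximal_iff.1 h
  exact hrs ((abs_eigenvalue_eq_one (abs_det_normalize A) hcon hv hrv).trans
    (abs_eigenvalue_eq_one (abs_det_normalize A) hcon hw hsw).symm)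

/-- An eigenvector of a power with simple eigenvalue is an eigenvector. -/
theorem exists_eigen_of_commute {A B : Matrix (Fin 2) (Fin 2) ℝ} (hAB : A * B = B * A)
    {v : Fin 2 → ℝ} (hv : v ≠ 0) {x : ℝ} (hBv : B.mulVec v = x • v) (hx : x * x ≠ B.det) :
    ∃ r : ℝ, A.mulVec v = r • v := by
  refine exists_smul_of_area_eq_zero hv ?_
  have h1 := area_mulVec B v (A.mulVec v)
  rw [Matrix.mulVec_mulVec, ← hAB, ← Matrix.mulVec_mulVec, hBv, Matrix.mulVec_smul,
    area_smul_left, area_smul_right, ← mul_assoc] at h1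
  by_contra h0
  exact hx (mul_right_cancel₀ h0 h1)

theorem exists_eigenvector {B : Matrix (Fin 2) (Fin 2) ℝ} {x : ℝ}
    (hx : x * x - B.trace * x + B.det = 0) : ∃ v, v ≠ 0 ∧ B.mulVec v = x • v := by
  have hdet : (B - x • 1).det = 0 := by
    rw [← hx]
    simp [Matrix.det_fin_two, Matrix.trace_fin_two]
    ring
  obtain ⟨v, hv, hv0⟩ := Matrix.exists_mulVec_eq_zero_iff.2 hdet
  refine ⟨v, hv, ?_⟩
  rw [Matrix.sub_mulVec, Matrix.smul_mulVec, Matrix.one_mulVec] at hv0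
  exact sub_eq_zero.1 hv0

theorem norm_sq_le_trace {B : Matrix (Fin 2) (Fin 2) ℝ} (hB : |B.det| = 1) :
    ‖B ^ 2‖ ≤ |B.trace| * ‖B‖ + 1 := by
  have e : B ^ 2 = B.trace • B - B.det • 1 := by
    ext i j
    fin_cases i <;> fin_cases j <;>
      simp [sq, Matrix.mul_apply, Matrix.det_fin_two, Matrix.trace_fin_two] <;> ring
  rw [e]
  refine (norm_sub_le _ _).trans ?_
  rw [norm_smul, norm_smul, norm_one_matrix, Real.norm_eq_abs, Real.norm_eq_abs, hB, mul_one]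

/-- By the Cayley-Hamilton theorem, a matrix one of whose powers `B` is large, with
`‖B ^ 2‖` comparable to `‖B‖ ^ 2`, has a large trace, and is therefore proximal. -/
theorem isProximal_of_norm_pow {A : GL (Fin 2) ℝ} {κ : ℝ} {n : ℕ}
    (h1 : κ * ‖normalize A ^ n‖ * ‖normalize A ^ n‖ ≤ ‖(normalize A ^ n) ^ 2‖)
    (h2 : 4 < κ * ‖normalize A ^ n‖) : IsProximal A := by
  set B := normalize A ^ n with hB
  have hdet : |B.det| = 1 := by rw [hB, ← map_pow]; exact abs_det_normalize _
  have hB1 := one_le_norm hdet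
  have htr : 2 < |B.trace| := by
    have h3 := norm_sq_le_trace hdet
    have h4 : 4 * ‖B‖ < κ * ‖B‖ * ‖B‖ := by gcongr
    by_contra! h
    nlinarith [mul_le_mul_of_nonneg_right h (norm_nonneg B)]
  have htr2 : 4 < B.trace ^ 2 := by
    rw [← sq_abs]; nlinarith
  have hd4 : 4 * B.det ≤ 4 := by linarith [le_abs_self B.det]
  set D := B.trace ^ 2 - 4 * B.det with hD
  have hD0 : 0 < D := by linarith
  have hDs : √D * √D = D := Real.mul_self_sqrt hD0.le
  have hDpos : 0 < √D := Real.sqrt_pos.2 hD0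
  set x := (B.trace + √D) / 2 with hx
  set y := (B.trace - √D) / 2 with hy
  have hxy : x ≠ y := fun h => by rw [hx, hy] at h; linarith
  have hxdet : x * y = B.det := by rw [hx, hy]; linarith
  have hx0 : x ≠ 0 := fun h => by
    rw [h, zero_mul] at hxdet; rw [← hxdet] at hdet; simp at hdet
  have hy0 : y ≠ 0 := fun h => by
    rw [h, mul_zero] at hxdet; rw [← hxdet] at hdet; simp at hdet
  have habs : |x| ≠ |y| := fun h => by
    rcases abs_eq_abs.1 h with h | h
    · exact hxy h
    · have : B.trace = 0 := by rw [hx, hy] at h; linarith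
      rw [this] at htr; simp at htr; linarith
  obtain ⟨v, hv, hBv⟩ := exists_eigenvector (B := B) (x := x) (by rw [hx]; linarith)
  obtain ⟨w, hw, hBw⟩ := exists_eigenvector (B := B) (x := y) (by rw [hy]; linarith)
  have hcomm : normalize A * B = B * normalize A := ((Commute.refl _).pow_right n)
  obtain ⟨r, hr⟩ := exists_eigen_of_commute hcomm hv hBv fun h =>
    hxy (mul_left_cancel₀ hx0 (h.trans hxdet.symm))
  obtain ⟨s, hs⟩ := exists_eigen_of_commute hcomm hw hBw fun h =>
    hxy (mul_right_cancel₀ hy0 (hxdet.trans h.symm))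
  refine isProximal_iff.2 ⟨r, s, v, w, fun hrs => habs ?_, hv, hw, hr, hs⟩
  have e1 : r ^ n = x := by
    have := pow_mulVec_of_eigen hr n
    rw [← hB, hBv] at this
    exact (smul_left_injective ℝ hv this).symm
  have e2 : s ^ n = y := by
    have := pow_mulVec_of_eigen hs n
    rw [← hB, hBw] at this
    exact (smul_left_injective ℝ hw this).symm
  rw [← e1, ← e2, abs_pow, abs_pow, hrs]

/-! ### Almost multiplicative semigroups of proximal matrices are dominated -/

theorem pow_mem_closure {𝒜 : Set (GL (Fin 2) ℝ)} {A : GL (Fin 2) ℝ}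
    (h : A ∈ Subsemigroup.closure 𝒜) (n : ℕ) :
    A ^ n ∈ Subsemigroup.closure 𝒜 ∨ A ^ n = 1 := by
  induction n with
  | zero => exact .inr (pow_zero A)
  | succ n ih =>
    rw [pow_succ]
    rcases ih with ih | ih
    · exact .inl (mul_mem ih h)
    · rw [ih, one_mul]; exact .inl h

/-- If there are arbitrarily long words of bounded normalized norm, then some subword is, after
normalization, close to the identity, and its first letter is nearly inverted by an element of the
semigroup. -/
theorem exists_near_inverse {𝒜 : Set (GL (Fin 2) ℝ)} {κ : ℝ} (hκ : 0 < κ)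
    (hmul : ∀ A B, (A ∈ Subsemigroup.closure 𝒜 ∨ A = 1) →
      (B ∈ Subsemigroup.closure 𝒜 ∨ B = 1) →
      κ * ‖normalize A‖ * ‖normalize B‖ ≤ ‖normalize (A * B)‖) {R : ℝ}
    (hbdd : ∀ N : ℕ, ∃ l : List (GL (Fin 2) ℝ), l.length = N ∧ (∀ A ∈ l, A ∈ 𝒜) ∧
      ‖normalize l.prod‖ ≤ R) {ε : ℝ} (hε : 0 < ε) :
    ∃ A ∈ 𝒜, ∃ W ∈ Subsemigroup.closure 𝒜, ‖normalize (A * W) - 1‖ ≤ ε := by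
  set R' := max (R / κ) 1 with hR'
  have hR'0 : 0 < R' := lt_of_lt_of_le one_pos (le_max_right _ _)
  set ε' := min 1 (ε / 3) / R' with hε'
  obtain ⟨t, ht⟩ := exists_close_pair R' (ε := ε') (by positivity)
  obtain ⟨l, hlen, hl, hlR⟩ := hbdd t
  have hT : ∀ k, ‖normalize (l.take k).prod‖ ≤ R' := fun k => by
    have h1 := hmul (l.take k).prod (l.drop k).prod
      (list_prod_mem_closure fun A hA => hl A (List.mem_of_mem_take hA))
      (list_prod_mem_closure fun A hA => hl A (List.mem_of_mem_drop hA))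
    rw [← List.prod_append, List.take_append_drop] at h1
    have h2 := le_mul_of_one_le_right (mul_nonneg hκ.le (norm_nonneg (normalize (l.take k).prod)))
      (one_le_norm_normalize (l.drop k).prod)
    refine le_trans ?_ (le_max_left _ _)
    rw [le_div_iff₀ hκ]
    linarith
  obtain ⟨p, q, hpq, hqt, hclose⟩ := ht (fun k => normalize (l.take k).prod) fun k _ => hT k
  set Q := (l.take q).drop p with hQ
  have hQl : ∀ A ∈ Q, A ∈ 𝒜 := fun A hA =>
    hl A (List.mem_of_mem_take (List.mem_of_mem_drop hA))
  have hsplit : (l.take q).prod = (l.take p).prod * Q.prod := by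
    rw [hQ, ← List.prod_append]
    congr 1
    conv_lhs => rw [← List.take_append_drop p (l.take q)]
    rw [List.take_take, min_eq_left hpq.le]
  have hQlen : Q.length = q - p := by
    simp [hQ, hlen, hqt]
  set T := (l.take p).prod with hTdef
  have hE : ‖normalize Q.prod - 1‖ ≤ min 1 (ε / 3) := by
    have e : normalize Q.prod - 1 = normalize T⁻¹ * (normalize (l.take q).prod - normalize T) := by
      rw [mul_sub, ← map_mul, ← map_mul, hsplit, inv_mul_cancel_left, inv_mul_cancel, map_one]
    rw [e]
    refine (norm_mul_le _ _).trans ?_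
    rw [norm_normalize_inv]
    calc ‖normalize T‖ * ‖normalize (l.take q).prod - normalize T‖
        ≤ R' * ε' := mul_le_mul (hT p) hclose.le (norm_nonneg _) hR'0.le
      _ = _ := by rw [hε']; field_simp
  rcases hQcase : Q with _ | ⟨A, V⟩
  · rw [hQcase] at hQlen; simp at hQlen; omega
  have hAV : Q.prod = A * V.prod := by rw [hQcase, List.prod_cons]
  have hQS : Q.prod ∈ Subsemigroup.closure 𝒜 := by
    rw [hAV]
    have hA : A ∈ Subsemigroup.closure 𝒜 := Subsemigroup.subset_closure (hQl A (by simp [hQcase]))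
    rcases list_prod_mem_closure (𝒜 := 𝒜) (l := V)
      fun B hB => hQl B (by simp [hQcase, hB]) with h | h
    · exact mul_mem hA h
    · rwa [h, mul_one]
  refine ⟨A, hQl A (by simp [hQcase]), V.prod * Q.prod, ?_, ?_⟩
  · rcases list_prod_mem_closure (𝒜 := 𝒜) (l := V)
      fun B hB => hQl B (by simp [hQcase, hB]) with h | h
    · exact mul_mem h hQS
    · rwa [h, one_mul]
  · rw [← mul_assoc, ← hAV, map_mul]
    set E := normalize Q.prod - 1 with hEdef
    have e : normalize Q.prod * normalize Q.prod - 1 = E * E + (E + E) := by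
      rw [hEdef]; noncomm_ring
    rw [e]
    have h1 : ‖E‖ ≤ 1 := hE.trans (min_le_left _ _)
    have h3 : ‖E‖ ≤ ε / 3 := hE.trans (min_le_right _ _)
    have h4 : ‖E * E‖ ≤ 1 * ‖E‖ :=
      (norm_mul_le _ _).trans (mul_le_mul_of_nonneg_right h1 (norm_nonneg _))
    linarith [norm_add_le (E * E) (E + E), norm_add_le E E]

theorem exists_length_norm_ge {𝒜 : Set (GL (Fin 2) ℝ)} (h𝒜 : IsCompact 𝒜)
    (hprox : ∀ A ∈ 𝒜, IsProximal A) {κ : ℝ} (hκ : 0 < κ)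
    (hmul : ∀ A B, (A ∈ Subsemigroup.closure 𝒜 ∨ A = 1) →
      (B ∈ Subsemigroup.closure 𝒜 ∨ B = 1) →
      κ * ‖normalize A‖ * ‖normalize B‖ ≤ ‖normalize (A * B)‖) (R : ℝ) :
    ∃ N : ℕ, ∀ l : List (GL (Fin 2) ℝ), l.length = N → (∀ A ∈ l, A ∈ 𝒜) →
      R < ‖normalize l.prod‖ := by
  by_contra! hcon
  obtain ⟨M, hM1, hM⟩ := exists_norm_normalize_le h𝒜
  choose A hA W hW hAW using fun k : ℕ =>
    exists_near_inverse hκ hmul hcon (Nat.one_div_pos_of_nat (α := ℝ) (n := k))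
  obtain ⟨a, ⟨L, hL, rfl⟩, φ, hφ, hlim⟩ := (h𝒜.image continuous_normalize).tendsto_subseq
    fun k => Set.mem_image_of_mem normalize (hA k)
  have hAWlim : Tendsto (fun k => ‖normalize (A (φ k) * W (φ k)) - 1‖) atTop (𝓝 0) :=
    (squeeze_zero (fun _ => norm_nonneg _) hAW
      tendsto_one_div_add_atTop_nhds_zero_nat).comp hφ.tendsto_atTop
  have hWM : ∀ k, ‖normalize (W k)‖ ≤ M * 2 := fun k => by
    refine (norm_normalize_le_mul (A k) (W k)).trans ?_
    have h1 : ‖normalize (A k * W k)‖ ≤ 2 := by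
      have h2 := norm_add_le (normalize (A k * W k) - 1) 1
      rw [sub_add_cancel, norm_one_matrix] at h2
      have h3 : 1 / ((k : ℝ) + 1) ≤ 1 := by
        rw [div_le_one (by positivity)]
        linarith [(Nat.cast_nonneg k : (0 : ℝ) ≤ k)]
      linarith [hAW k]
    exact mul_le_mul (hM _ (hA k)) h1 (norm_nonneg _) (by linarith)
  have hWlim : Tendsto (fun k => normalize (W (φ k))) atTop (𝓝 (normalize L⁻¹)) := by
    rw [tendsto_iff_norm_sub_tendsto_zero]
    have hlim' : Tendsto (fun k => ‖normalize L - normalize (A (φ k))‖) atTop (𝓝 0) := by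
      have := tendsto_iff_norm_sub_tendsto_zero.1 hlim
      refine this.congr fun k => ?_
      rw [norm_sub_rev]; rfl
    have hb : Tendsto (fun k => ‖normalize L⁻¹‖ * (‖normalize L - normalize (A (φ k))‖ * (M * 2) +
        ‖normalize (A (φ k) * W (φ k)) - 1‖)) atTop (𝓝 0) := by
      simpa using ((hlim'.mul_const (M * 2)).add hAWlim).const_mul ‖normalize L⁻¹‖
    refine squeeze_zero (fun _ => norm_nonneg _) (fun k => ?_) hb
    have e : normalize (W (φ k)) - normalize L⁻¹ = normalize L⁻¹ *
        ((normalize L - normalize (A (φ k))) * normalize (W (φ k)) +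
          (normalize (A (φ k) * W (φ k)) - 1)) := by
      have h1 : normalize L⁻¹ * normalize L = 1 := by rw [← map_mul, inv_mul_cancel, map_one]
      rw [map_mul, sub_mul, sub_add_sub_cancel, mul_sub, ← mul_assoc, h1, one_mul, mul_one]
    rw [e]
    refine (norm_mul_le _ _).trans (mul_le_mul_of_nonneg_left ?_ (norm_nonneg _))
    refine (norm_add_le _ _).trans (add_le_add_left ((norm_mul_le _ _).trans ?_) _)
    exact mul_le_mul_of_nonneg_left (hWM _) (norm_nonneg _)
  obtain ⟨n, hn⟩ := (hprox L hL).exists_norm_pow_gt κ⁻¹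
  have hineq : ∀ k, κ * ‖normalize (A k) ^ n‖ ≤ ‖normalize (A k) ^ n * normalize (W k) ^ n‖ :=
    fun k => by
      have h1 := hmul (A k ^ n) (W k ^ n)
        (pow_mem_closure (Subsemigroup.subset_closure (hA k)) n) (pow_mem_closure (hW k) n)
      have h2 := le_mul_of_one_le_right (mul_nonneg hκ.le (norm_nonneg (normalize (A k ^ n))))
        (one_le_norm_normalize (W k ^ n))
      have h3 := h2.trans h1
      rwa [map_mul, map_pow, map_pow] at h3
  have hl1 : Tendsto (fun k => κ * ‖normalize (A (φ k)) ^ n‖) atTop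
      (𝓝 (κ * ‖normalize L ^ n‖)) := ((hlim.pow n).norm).const_mul κ
  have hl2 : Tendsto (fun k => ‖normalize (A (φ k)) ^ n * normalize (W (φ k)) ^ n‖) atTop
      (𝓝 ‖normalize L ^ n * normalize L⁻¹ ^ n‖) := ((hlim.pow n).mul (hWlim.pow n)).norm
  have hfin := le_of_tendsto_of_tendsto' hl1 hl2 fun k => hineq (φ k)
  have e : normalize L ^ n * normalize L⁻¹ ^ n = 1 := by
    rw [← map_pow, ← map_pow, ← map_mul, inv_pow, mul_inv_cancel, map_one]
  rw [e, norm_one_matrix] at hfin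
  have := mul_lt_mul_of_pos_left hn hκ
  rw [mul_inv_cancel₀ hκ.ne'] at this
  linarith

theorem isDominated_of_isProximal {𝒜 : Set (GL (Fin 2) ℝ)} (h𝒜 : IsCompact 𝒜)
    (hprox : ∀ A ∈ 𝒜, IsProximal A) (hmul : IsAlmostMultiplicative (Subsemigroup.closure 𝒜)) :
    IsDominated 𝒜 := by
  obtain ⟨κ, hκ, hκ1, hmul⟩ := isAlmostMultiplicative_iff.1 hmul
  obtain ⟨N, hN⟩ := exists_length_norm_ge h𝒜 hprox hκ hmul (2 / κ)
  have hN0 : N ≠ 0 := by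
    rintro rfl
    have := hN [] rfl (by simp)
    rw [List.prod_nil, map_one, norm_one_matrix, div_lt_one hκ] at this
    linarith
  have hq : ∀ (q : ℕ) (l : List (GL (Fin 2) ℝ)), N * q ≤ l.length → (∀ A ∈ l, A ∈ 𝒜) →
      κ * 2 ^ q ≤ ‖normalize l.prod‖ := by
    intro q
    induction q with
    | zero =>
      intro l _ _
      rw [pow_zero, mul_one]
      exact hκ1.trans (one_le_norm_normalize _)
    | succ q ih =>
      intro l hlen hl
      rw [Nat.mul_succ] at hlen
      have h1 := hmul (l.take N).prod (l.drop N).prod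
        (list_prod_mem_closure fun A hA => hl A (List.mem_of_mem_take hA))
        (list_prod_mem_closure fun A hA => hl A (List.mem_of_mem_drop hA))
      rw [← List.prod_append, List.take_append_drop] at h1
      have h2 := hN (l.take N) (by simp; omega) fun A hA => hl A (List.mem_of_mem_take hA)
      have h3 := ih (l.drop N) (by simp; omega) fun A hA => hl A (List.mem_of_mem_drop hA)
      refine le_trans ?_ h1
      calc κ * 2 ^ (q + 1) = κ * (2 / κ) * (κ * 2 ^ q) := by field_simp; ring
        _ ≤ _ := by gcongr
  set τ : ℝ := (1 / 4) ^ ((N : ℝ)⁻¹) with hτ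
  have hτN : τ ^ N = 1 / 4 := Real.rpow_inv_natCast_pow (by norm_num) hN0
  have hτ0 : 0 < τ := by positivity
  have hτ1 : τ < 1 := by
    by_contra! h
    have := one_le_pow₀ (n := N) h
    rw [hτN] at this; norm_num at this
  refine isDominated_iff.2 ⟨4 * (κ ^ 2)⁻¹, τ, by positivity, hτ0, hτ1, fun l _ hl => ?_⟩
  set q := l.length / N with hqdef
  have h1 := hq q l (Nat.mul_div_le _ _) hl
  have h2 : l.length ≤ N * (q + 1) := (Nat.lt_mul_div_succ _ (Nat.pos_of_ne_zero hN0)).le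
  have h3 : (1 / 4 : ℝ) ^ q * (1 / 4) ≤ τ ^ l.length := by
    rw [← pow_succ, ← hτN, ← pow_mul]
    exact pow_le_pow_of_le_one hτ0.le hτ1.le h2
  calc (‖normalize l.prod‖ ^ 2)⁻¹ ≤ ((κ * 2 ^ q) ^ 2)⁻¹ := by gcongr
    _ = (κ ^ 2)⁻¹ * (1 / 4) ^ q := by
      rw [mul_pow, mul_inv, ← pow_mul, mul_comm q, pow_mul, one_div, inv_pow]; norm_num
    _ ≤ (κ ^ 2)⁻¹ * (4 * τ ^ l.length) := by
      gcongr
      linarith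
    _ = _ := by ring

/-! ### Strictly invariant cones -/

/-- A set `K` of nonzero vectors, closed under nonzero scalars and closed in the punctured plane,
together with an open subset `U` of the same kind, such that the matrices of `𝒜` map `K` into `U`:
the preimages in the plane of a closed subset of the projective line and of its interior. -/
structure IsInvariantCone (𝒜 : Set (GL (Fin 2) ℝ)) (K U : Set (Fin 2 → ℝ)) : Prop where
  ne_zero : ∀ v ∈ K, v ≠ 0
  smul_mem : ∀ c : ℝ, c ≠ 0 → ∀ v ∈ K, c • v ∈ K
  smul_mem' : ∀ c : ℝ, c ≠ 0 → ∀ v ∈ U, c • v ∈ U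
  subset : U ⊆ K
  isClosed : IsClosed (K ∪ {0})
  isOpen : IsOpen U
  mapsTo : ∀ A ∈ 𝒜, ∀ v ∈ K, (normalize A).mulVec v ∈ U

theorem exists_transversality {𝒜 : Set (GL (Fin 2) ℝ)} (h𝒜 : IsCompact 𝒜)
    {K U : Set (Fin 2 → ℝ)} (h : IsInvariantCone 𝒜 K U) :
    ∃ δ : ℝ, 0 < δ ∧ ∀ A ∈ 𝒜, ∀ v ∈ K, ∀ z, z ∉ U →
      δ * vnorm ((normalize A).mulVec v) * vnorm z ≤ |area ((normalize A).mulVec v) z| := by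
  obtain ⟨M, hM1, hM⟩ := exists_norm_normalize_le h𝒜
  have hM0 : 0 < M := by linarith
  have hK : IsCompact (K ∩ {v | vnorm v = 1}) := by
    have e : K ∩ {v | vnorm v = 1} = {v | vnorm v = 1} ∩ (K ∪ {0}) := by
      ext v
      constructor
      · exact fun hv => ⟨hv.2, .inl hv.1⟩
      · rintro ⟨hv, hv' | hv'⟩
        · exact ⟨hv', hv⟩
        · rw [Set.mem_singleton_iff] at hv'
          simp [hv', vnorm_eq_zero.2] at hv
    rw [e]
    exact isCompact_unit.inter_right h.isClosed
  have hZ : IsCompact ({z | vnorm z = 1} ∩ Uᶜ) := isCompact_unit.inter_right h.isOpen.isClosed_compl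
  have hcont : Continuous fun x : GL (Fin 2) ℝ × (Fin 2 → ℝ) × (Fin 2 → ℝ) =>
      |area ((normalize x.1).mulVec x.2.1) x.2.2| := by
    have := (continuous_normalize.comp
      (continuous_fst (X := GL (Fin 2) ℝ) (Y := (Fin 2 → ℝ) × (Fin 2 → ℝ)))).matrix_mulVec
        (continuous_fst.comp continuous_snd)
    exact (this.area (continuous_snd.comp continuous_snd)).abs
  obtain ⟨δ, hδ, hle⟩ := (h𝒜.prod (hK.prod hZ)).exists_forall_le' hcont.continuousOn (a := 0) (by
    rintro ⟨A, v, z⟩ ⟨hA, ⟨hv, -⟩, hz1, hz⟩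
    refine abs_pos.2 fun h0 => hz ?_
    obtain ⟨c, rfl⟩ := exists_smul_of_area_eq_zero
      (mulVec_ne_zero (abs_det_normalize A) (h.ne_zero v hv)) h0
    refine h.smul_mem' c ?_ _ (h.mapsTo A hA v hv)
    rintro rfl
    simp [vnorm_eq_zero.2] at hz1)
  refine ⟨δ / M, by positivity, fun A hA v hv z hz => ?_⟩
  by_cases hz0 : z = 0
  · simp [hz0, vnorm_eq_zero.2]
  have hv0 := h.ne_zero v hv
  have hvp := vnorm_pos.2 hv0
  have hzp := vnorm_pos.2 hz0
  have h1 := hle (A, (vnorm v)⁻¹ • v, (vnorm z)⁻¹ • z) ⟨hA,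
    ⟨h.smul_mem _ (inv_ne_zero hvp.ne') v hv, vnorm_unit hv0⟩, vnorm_unit hz0, fun hcon => hz (by
      have := h.smul_mem' (vnorm z) hzp.ne' _ hcon
      rwa [smul_smul, mul_inv_cancel₀ hzp.ne', one_smul] at this)⟩
  simp only [Matrix.mulVec_smul, area_smul_left, area_smul_right, abs_mul, abs_inv,
    abs_of_pos hvp, abs_of_pos hzp] at h1
  have h2 : δ * vnorm v * vnorm z ≤ |area ((normalize A).mulVec v) z| := by
    have := mul_le_mul_of_nonneg_right h1 (mul_pos hvp hzp).le
    refine (le_of_eq ?_).trans (this.trans (le_of_eq ?_))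
    · ring
    · field_simp
  have h3 : vnorm ((normalize A).mulVec v) ≤ M * vnorm v :=
    (vnorm_mulVec_le _ _).trans (mul_le_mul_of_nonneg_right (hM A hA) hvp.le)
  refine le_trans ?_ h2
  calc δ / M * vnorm ((normalize A).mulVec v) * vnorm z ≤ δ / M * (M * vnorm v) * vnorm z := by
        gcongr
    _ = _ := by field_simp

/-- The norm of a matrix is controlled by its values on a basis. -/
theorem exists_norm_le_basis {z₁ z₂ : Fin 2 → ℝ} (hz : area z₁ z₂ ≠ 0) :
    ∃ c : ℝ, 0 < c ∧ ∀ (A : Matrix (Fin 2) (Fin 2) ℝ) (b : ℝ), vnorm (A.mulVec z₁) ≤ b →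
      vnorm (A.mulVec z₂) ≤ b → ‖A‖ ≤ c * b := by
  have hpos := abs_pos.2 hz
  have hz1 : 0 < vnorm z₁ := vnorm_pos.2 fun h => hz (by simp [h, area])
  have hz2 : 0 < vnorm z₂ := vnorm_pos.2 fun h => hz (by simp [h, area])
  refine ⟨(vnorm z₁ + vnorm z₂) / |area z₁ z₂|, by positivity, fun A b h1 h2 => ?_⟩
  have hb := (vnorm_nonneg _).trans h1
  refine norm_le_of_vnorm_mulVec_le (by positivity) fun y => ?_
  have e : y = (area y z₂ / area z₁ z₂) • z₁ + (area z₁ y / area z₁ z₂) • z₂ := by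
    ext i
    simp only [Pi.add_apply, Pi.smul_apply, smul_eq_mul]
    rw [div_mul_eq_mul_div, div_mul_eq_mul_div, ← add_div, eq_div_iff hz]
    fin_cases i <;> simp [area] <;> ring
  conv_lhs => rw [e, Matrix.mulVec_add, Matrix.mulVec_smul, Matrix.mulVec_smul]
  refine (vnorm_add_le _ _).trans ?_
  rw [vnorm_smul, vnorm_smul, abs_div, abs_div]
  calc |area y z₂| / |area z₁ z₂| * vnorm (A.mulVec z₁) +
        |area z₁ y| / |area z₁ z₂| * vnorm (A.mulVec z₂)
      ≤ vnorm y * vnorm z₂ / |area z₁ z₂| * b + vnorm z₁ * vnorm y / |area z₁ z₂| * b := by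
        have h3 := abs_area_le y z₂
        have h4 := abs_area_le z₁ y
        have h5 := vnorm_nonneg (A.mulVec z₁)
        have h6 := vnorm_nonneg (A.mulVec z₂)
        have h7 := vnorm_nonneg y
        gcongr
    _ = _ := by ring

theorem exists_eq_mul_of_mem_closure {𝒜 : Set (GL (Fin 2) ℝ)} {A : GL (Fin 2) ℝ}
    (h : A ∈ Subsemigroup.closure 𝒜) : ∃ A', (A' ∈ Subsemigroup.closure 𝒜 ∨ A' = 1) ∧
      ∃ B ∈ 𝒜, A = A' * B := by
  obtain ⟨l, hl0, hl, rfl⟩ := exists_list_of_mem_closure h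
  refine ⟨l.dropLast.prod, list_prod_mem_closure fun B hB => hl B (List.mem_of_mem_dropLast hB),
    l.getLast hl0, hl _ (List.getLast_mem hl0), ?_⟩
  conv_lhs => rw [← List.dropLast_append_getLast hl0]
  simp

namespace IsInvariantCone

variable {𝒜 : Set (GL (Fin 2) ℝ)} {K U : Set (Fin 2 → ℝ)}

theorem mulVec_mem (h : IsInvariantCone 𝒜 K U) {A : GL (Fin 2) ℝ}
    (hA : A ∈ Subsemigroup.closure 𝒜 ∨ A = 1) : ∀ v ∈ K, (normalize A).mulVec v ∈ K := by
  rcases hA with hA | rfl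
  · induction hA using Subsemigroup.closure_induction with
    | mem A hA => exact fun v hv => h.subset (h.mapsTo A hA v hv)
    | mul A B _ _ ihA ihB =>
      intro v hv
      rw [map_mul, ← Matrix.mulVec_mulVec]
      exact ihA _ (ihB v hv)
  · intro v hv
    rwa [map_one, Matrix.one_mulVec]

/-- Vectors of a strictly invariant cone are expanded, by all elements of the semigroup, as much as
the norm allows up to a constant. -/
theorem exists_expansion (h : IsInvariantCone 𝒜 K U) (h𝒜 : IsCompact 𝒜)
    (hproper : ∃ z, z ≠ 0 ∧ z ∉ K) :
    ∃ c : ℝ, 0 < c ∧ ∀ A ∈ Subsemigroup.closure 𝒜, ∀ v ∈ K,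
      c * ‖normalize A‖ * vnorm v ≤ vnorm ((normalize A).mulVec v) := by
  obtain ⟨M, hM1, hM⟩ := exists_norm_normalize_le h𝒜
  obtain ⟨δ, hδ, htrans⟩ := exists_transversality h𝒜 h
  obtain ⟨z₁, hz₁, hz₁K⟩ := hproper
  -- the complement of `K` is open, so contains a basis
  obtain ⟨z₂, hz₂K, hz₁₂⟩ : ∃ z₂, z₂ ∉ K ∧ area z₁ z₂ ≠ 0 := by
    have hcont : Continuous fun t : ℝ => z₁ + t • rot z₁ := by fun_prop
    have hmem : (fun t : ℝ => z₁ + t • rot z₁) ⁻¹' (K ∪ {0})ᶜ ∈ 𝓝 (0 : ℝ) := by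
      refine (h.isClosed.isOpen_compl.preimage hcont).mem_nhds ?_
      simp [hz₁K, hz₁]
    obtain ⟨t, ht, ht0⟩ := ((eventually_nhdsWithin_of_eventually_nhds
      (s := {0}ᶜ) hmem).and self_mem_nhdsWithin).exists
    refine ⟨z₁ + t • rot z₁, fun hcon => ht (.inl hcon), ?_⟩
    rw [area_add_right, area_self, area_smul_right, area_rot, zero_add]
    exact mul_ne_zero ht0 (pow_ne_zero 2 (vnorm_pos.2 hz₁).ne')
  obtain ⟨c, hc, hbasis⟩ := exists_norm_le_basis hz₁₂
  set b := max (vnorm z₁) (vnorm z₂) with hb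
  have hb0 : 0 < b := lt_max_of_lt_left (vnorm_pos.2 hz₁)
  have key : ∀ A, (A ∈ Subsemigroup.closure 𝒜 ∨ A = 1) → ∀ B ∈ 𝒜, ∀ v ∈ K,
      δ * ‖normalize A‖ * vnorm ((normalize B).mulVec v) ≤
        c * b * vnorm ((normalize A).mulVec ((normalize B).mulVec v)) := by
    intro A hA B hB v hv
    set p := (normalize B).mulVec v with hp
    have hp0 : 0 < vnorm p := vnorm_pos.2 (mulVec_ne_zero (abs_det_normalize B) (h.ne_zero v hv))
    -- preimages of vectors outside `K` are outside `U`, hence transverse to `p`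
    have hz : ∀ z, z ∉ K → vnorm z ≤ b → vnorm ((normalize A⁻¹).mulVec z) ≤
        b * vnorm ((normalize A).mulVec p) / (δ * vnorm p) := by
      intro z hzK hzb
      have h1 := htrans B hB v hv ((normalize A⁻¹).mulVec z) fun hcon => hzK (by
        have := h.mulVec_mem hA _ (h.subset hcon)
        rwa [normalize_mulVec_inv] at this)
      rw [← hp, ← abs_area_mulVec (abs_det_normalize A), normalize_mulVec_inv] at h1
      rw [le_div_iff₀ (by positivity)]
      have h2 := abs_area_le ((normalize A).mulVec p) z
      have h3 := mul_le_mul_of_nonneg_left hzb (vnorm_nonneg ((normalize A).mulVec p))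
      linarith
    have h1 := hbasis (normalize A⁻¹) _ (hz z₁ hz₁K (le_max_left _ _))
      (hz z₂ hz₂K (le_max_right _ _))
    rw [norm_normalize_inv, ← mul_div_assoc, le_div_iff₀ (by positivity)] at h1
    linarith
  refine ⟨δ / (c * b * M ^ 2), by positivity, fun A hA v hv => ?_⟩
  obtain ⟨A', hA', B, hB, rfl⟩ := exists_eq_mul_of_mem_closure hA
  have h1 := key A' hA' B hB v hv
  rw [Matrix.mulVec_mulVec, ← map_mul] at h1
  have h2 : ‖normalize (A' * B)‖ ≤ ‖normalize A'‖ * M :=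
    (norm_normalize_mul_le A' B).trans (mul_le_mul_of_nonneg_left (hM B hB) (norm_nonneg _))
  have h3 : vnorm v ≤ M * vnorm ((normalize B).mulVec v) :=
    (vnorm_le_norm_mul_vnorm_mulVec (abs_det_normalize B) v).trans
      (mul_le_mul_of_nonneg_right (hM B hB) (vnorm_nonneg _))
  have hM0 : 0 < M := by linarith
  rw [div_mul_eq_mul_div, div_mul_eq_mul_div, div_le_iff₀ (by positivity)]
  calc δ * ‖normalize (A' * B)‖ * vnorm v
      ≤ δ * (‖normalize A'‖ * M) * (M * vnorm ((normalize B).mulVec v)) := by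
        have := vnorm_nonneg v
        gcongr
    _ = (δ * ‖normalize A'‖ * vnorm ((normalize B).mulVec v)) * M ^ 2 := by ring
    _ ≤ (c * b * vnorm ((normalize (A' * B)).mulVec v)) * M ^ 2 := by gcongr
    _ = _ := by ring

theorem isAlmostMultiplicative (h : IsInvariantCone 𝒜 K U) (h𝒜 : IsCompact 𝒜)
    (hne : K.Nonempty) (hproper : ∃ z, z ≠ 0 ∧ z ∉ K) :
    IsAlmostMultiplicative (Subsemigroup.closure 𝒜) := by
  obtain ⟨c, hc, hexp⟩ := h.exists_expansion h𝒜 hproper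
  obtain ⟨v, hv⟩ := hne
  have hv0 := vnorm_pos.2 (h.ne_zero v hv)
  refine isAlmostMultiplicative_iff.2 ⟨min (c ^ 2) 1, by positivity, min_le_right _ _, ?_⟩
  rintro A B (hA | rfl) (hB | rfl)
  · refine (mul_le_mul_of_nonneg_right (mul_le_mul_of_nonneg_right (min_le_left _ _)
      (norm_nonneg _)) (norm_nonneg _)).trans ?_
    have h1 := hexp B hB v hv
    have h2 := hexp A hA _ (h.mulVec_mem (.inl hB) v hv)
    have h3 := vnorm_mulVec_le (normalize (A * B)) v
    rw [map_mul, ← Matrix.mulVec_mulVec] at h3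
    refine le_of_mul_le_mul_right ?_ hv0
    rw [map_mul]
    calc c ^ 2 * ‖normalize A‖ * ‖normalize B‖ * vnorm v
        = c * ‖normalize A‖ * (c * ‖normalize B‖ * vnorm v) := by ring
      _ ≤ c * ‖normalize A‖ * vnorm ((normalize B).mulVec v) := by gcongr
      _ ≤ _ := h2.trans h3
  · simpa [norm_one_matrix] using mul_le_of_le_one_left (norm_nonneg _) (min_le_right (c ^ 2) 1)
  · simpa [norm_one_matrix] using mul_le_of_le_one_left (norm_nonneg _) (min_le_right (c ^ 2) 1)
  · simp

/-- By connectedness of the circle, a proper strictly invariant cone has a boundary vector. -/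
theorem exists_boundary (h : IsInvariantCone 𝒜 K U) (hne : U.Nonempty)
    (hproper : ∃ z, z ≠ 0 ∧ z ∉ K) : ∃ v ∈ K, v ∉ U ∧ vnorm v = 1 := by
  by_contra! hcon
  obtain ⟨u, hu⟩ := hne
  obtain ⟨z, hz, hzK⟩ := hproper
  have hu0 := h.ne_zero u (h.subset hu)
  obtain ⟨x, -, hxU, hxK⟩ := isPreconnected_unit U (K ∪ {0})ᶜ h.isOpen h.isClosed.isOpen_compl
    (fun x hx => by
      by_cases hxK : x ∈ K ∪ {0}
      · left
        rcases hxK with hxK | hxK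
        · by_contra hxU
          exact hcon x hxK hxU hx
        · rw [Set.mem_singleton_iff] at hxK
          simp [hxK, vnorm_eq_zero.2] at hx
      · exact .inr hxK)
    ⟨_, vnorm_unit hu0, h.smul_mem' _ (inv_ne_zero (vnorm_pos.2 hu0).ne') u hu⟩
    ⟨_, vnorm_unit hz, by
      rintro (hcon | hcon)
      · have := h.smul_mem _ (vnorm_pos.2 hz).ne' _ hcon
        rw [smul_smul, mul_inv_cancel₀ (vnorm_pos.2 hz).ne', one_smul] at this
        exact hzK this
      · have := vnorm_unit hz
        rw [Set.mem_singleton_iff.1 hcon, vnorm_eq_zero.2 rfl] at this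
        exact zero_ne_one this⟩
  exact hxK (.inl (h.subset hxU))

theorem isProximal (h : IsInvariantCone 𝒜 K U) (h𝒜 : IsCompact 𝒜)
    (hne : K.Nonempty) (hproper : ∃ z, z ≠ 0 ∧ z ∉ K) {A : GL (Fin 2) ℝ} (hA : A ∈ 𝒜) :
    IsProximal A := by
  obtain ⟨κ, hκ, -, hmul⟩ := isAlmostMultiplicative_iff.1 (h.isAlmostMultiplicative h𝒜 hne hproper)
  by_contra hprox
  have hbdd : ∀ n, ‖normalize A ^ n‖ ≤ 4 / κ := fun n => by
    by_contra! hlt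
    rw [div_lt_iff₀' hκ] at hlt
    refine hprox (isProximal_of_norm_pow ?_ hlt)
    have hAn := pow_mem_closure (Subsemigroup.subset_closure hA) n
    have := hmul (A ^ n) (A ^ n) hAn hAn
    rwa [map_mul, map_pow, ← sq] at this
  obtain ⟨δ, hδ, htrans⟩ := exists_transversality h𝒜 h
  obtain ⟨k, hk⟩ := hne
  obtain ⟨v, hvK, hvU, hv1⟩ := h.exists_boundary ⟨_, h.mapsTo A hA k hk⟩ hproper
  set e := min (1 / 2) (δ / 4) with he
  obtain ⟨t, ht⟩ := exists_close_pair (4 / κ) (ε := e / (4 / κ)) (by positivity)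
  obtain ⟨p, q, hpq, -, hclose⟩ := ht (fun n => normalize A ^ n) fun n _ => hbdd n
  obtain ⟨m, rfl⟩ := Nat.exists_eq_add_of_lt hpq
  -- bounded powers are recurrent: `A ^ (m + 1)` is nearly a multiple of the identity
  have hnear : ‖normalize A ^ (m + 1) - 1‖ ≤ e := by
    have h1 : normalize A ^ (m + 1) - 1 =
        normalize (A ^ p)⁻¹ * (normalize A ^ (p + m + 1) - normalize A ^ p) := by
      have h2 : normalize (A ^ p)⁻¹ * normalize A ^ p = 1 := by
        rw [← map_pow, ← map_mul, inv_mul_cancel, map_one]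
      rw [mul_sub, h2, add_assoc, pow_add _ p, ← mul_assoc, h2, one_mul]
    rw [h1]
    refine (norm_mul_le _ _).trans ?_
    rw [norm_normalize_inv, map_pow]
    calc ‖normalize A ^ p‖ * ‖normalize A ^ (p + m + 1) - normalize A ^ p‖
        ≤ 4 / κ * (e / (4 / κ)) := mul_le_mul (hbdd p) hclose.le (norm_nonneg _) (by positivity)
      _ = e := by field_simp
  have h1 := htrans A hA _ (h.mulVec_mem (pow_mem_closure (Subsemigroup.subset_closure hA) m) v hvK)
    v hvU
  rw [Matrix.mulVec_mulVec, map_pow, ← pow_succ', hv1, mul_one] at h1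
  set x := (normalize A ^ (m + 1)).mulVec v with hx
  have hxv : vnorm (x - v) ≤ e := by
    have := vnorm_mulVec_le (normalize A ^ (m + 1) - 1) v
    rw [Matrix.sub_mulVec, Matrix.one_mulVec, ← hx, hv1, mul_one] at this
    exact this.trans hnear
  have h2 : |area x v| ≤ e := by
    have h3 : area x v = area (x - v) v := by rw [area_sub_left, area_self, sub_zero]
    rw [h3]
    refine (abs_area_le _ _).trans ?_
    rwa [hv1, mul_one]
  have h3 : 1 ≤ vnorm x + e := by
    have := vnorm_sub_le v x
    rw [vnorm_sub_comm, hv1] at this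
    linarith
  have h4 : e ≤ 1 / 2 := min_le_left _ _
  have h5 : e ≤ δ / 4 := min_le_right _ _
  nlinarith

end IsInvariantCone

/-! ### Construction of a strictly invariant cone -/

/-- The cone of nonzero vectors which every element `w` of the semigroup generated by `𝒜` (and the
identity) expands by at least `η * ‖w‖`, after normalization. -/
def expandedCone (𝒜 : Set (GL (Fin 2) ℝ)) (η : ℝ) : Set (Fin 2 → ℝ) :=
  {v | v ≠ 0 ∧ ∀ w, (w ∈ Subsemigroup.closure 𝒜 ∨ w = 1) →
    η * ‖normalize w‖ * vnorm v ≤ vnorm ((normalize w).mulVec v)}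

section ExpandedCone

variable {𝒜 : Set (GL (Fin 2) ℝ)}

theorem smul_mem_expandedCone {η c : ℝ} (hc : c ≠ 0) {v : Fin 2 → ℝ}
    (hv : v ∈ expandedCone 𝒜 η) : c • v ∈ expandedCone 𝒜 η := by
  refine ⟨smul_ne_zero hc hv.1, fun w hw => ?_⟩
  rw [Matrix.mulVec_smul, vnorm_smul, vnorm_smul]
  have := mul_le_mul_of_nonneg_left (hv.2 w hw) (abs_nonneg c)
  linarith

theorem expandedCone_mem_nhds {η η' : ℝ} (hη : η' < η) {v : Fin 2 → ℝ}
    (hv : v ∈ expandedCone 𝒜 η) : expandedCone 𝒜 η' ∈ 𝓝 v := by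
  have hv0 := vnorm_pos.2 hv.1
  have hopen : IsOpen {y : Fin 2 → ℝ | η' * vnorm y < η * vnorm v - vnorm (v - y)} :=
    isOpen_lt (by fun_prop) (by fun_prop)
  have hmem : v ∈ {y : Fin 2 → ℝ | η' * vnorm y < η * vnorm v - vnorm (v - y)} := by
    simpa [vnorm_eq_zero.2] using mul_lt_mul_of_pos_right hη hv0
  filter_upwards [hopen.mem_nhds hmem, isOpen_ne.mem_nhds hv.1] with y hy hy0
  refine ⟨hy0, fun w hw => ?_⟩
  have h1 := hv.2 w hw
  have h2 := vnorm_sub_le ((normalize w).mulVec v) ((normalize w).mulVec y)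
  rw [← Matrix.mulVec_sub] at h2
  have h3 := vnorm_mulVec_le (normalize w) (v - y)
  have h4 := mul_le_mul_of_nonneg_left (le_of_lt hy) (norm_nonneg (normalize w))
  linarith

theorem isCompact_expandedCone_inter (η : ℝ) :
    IsCompact (expandedCone 𝒜 η ∩ {v | vnorm v = 1}) := by
  have e : expandedCone 𝒜 η ∩ {v | vnorm v = 1} = {v | vnorm v = 1} ∩
      ⋂ (w : GL (Fin 2) ℝ) (_ : w ∈ Subsemigroup.closure 𝒜 ∨ w = 1),
        {v | η * ‖normalize w‖ * vnorm v ≤ vnorm ((normalize w).mulVec v)} := by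
    ext v
    simp only [Set.mem_inter_iff, Set.mem_iInter, Set.mem_ofPred_eq]
    constructor
    · exact fun h => ⟨h.2, h.1.2⟩
    · intro h
      exact ⟨⟨vnorm_pos.1 (by rw [h.1]; exact one_pos), h.2⟩, h.1⟩
  rw [e]
  refine isCompact_unit.inter_right (isClosed_iInter fun w => isClosed_iInter fun _ => ?_)
  exact isClosed_le (by fun_prop) (Continuous.vnorm (by fun_prop))

theorem mulVec_mem_expandedCone {κ η : ℝ} (hη : 0 ≤ η)
    (hmul : ∀ A B, (A ∈ Subsemigroup.closure 𝒜 ∨ A = 1) →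
      (B ∈ Subsemigroup.closure 𝒜 ∨ B = 1) →
      κ * ‖normalize A‖ * ‖normalize B‖ ≤ ‖normalize (A * B)‖) {w : GL (Fin 2) ℝ}
    (hw : w ∈ Subsemigroup.closure 𝒜 ∨ w = 1) (hκ : 0 ≤ κ) {v : Fin 2 → ℝ}
    (hv : v ∈ expandedCone 𝒜 η) : (normalize w).mulVec v ∈ expandedCone 𝒜 (κ * η) := by
  refine ⟨mulVec_ne_zero (abs_det_normalize w) hv.1, fun A hA => ?_⟩
  have hAw : A * w ∈ Subsemigroup.closure 𝒜 ∨ A * w = 1 := by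
    rcases hA with hA | rfl <;> rcases hw with hw | rfl
    · exact .inl (mul_mem hA hw)
    · exact .inl (by rwa [mul_one])
    · exact .inl (by rwa [one_mul])
    · exact .inr (mul_one 1)
  have h1 := hv.2 _ hAw
  rw [map_mul, ← Matrix.mulVec_mulVec] at h1
  refine le_trans ?_ h1
  have h2 := hmul A w hA hw
  rw [map_mul] at h2
  calc κ * η * ‖normalize A‖ * vnorm ((normalize w).mulVec v)
      ≤ κ * η * ‖normalize A‖ * (‖normalize w‖ * vnorm v) := by
        gcongr
        exact vnorm_mulVec_le _ _
    _ = η * (κ * ‖normalize A‖ * ‖normalize w‖) * vnorm v := by ring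
    _ ≤ η * ‖normalize A * normalize w‖ * vnorm v := by
        have := vnorm_nonneg v
        gcongr

/-- If `w` is long and expands `v` as much as its norm allows up to the factor `η`, then `w v` lies
in a cone whose aperture no longer depends on `η`: it is close to the image of the direction most
expanded by `w`. -/
theorem mulVec_mem_expandedCone_of_norm_ge {κ η : ℝ} (hκ : 0 < κ) (hη : 0 < η)
    (hmul : ∀ A B, (A ∈ Subsemigroup.closure 𝒜 ∨ A = 1) →
      (B ∈ Subsemigroup.closure 𝒜 ∨ B = 1) →
      κ * ‖normalize A‖ * ‖normalize B‖ ≤ ‖normalize (A * B)‖) {w : GL (Fin 2) ℝ}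
    (hw : w ∈ Subsemigroup.closure 𝒜 ∨ w = 1) {v : Fin 2 → ℝ} (hv : v ≠ 0)
    (hwv : η * ‖normalize w‖ * vnorm v ≤ vnorm ((normalize w).mulVec v))
    (hnorm : 4 / (η * κ) ≤ ‖normalize w‖ ^ 2) :
    (normalize w).mulVec v ∈ expandedCone 𝒜 (κ / 4) := by
  set p := (normalize w).mulVec v with hp
  have hp0 : p ≠ 0 := mulVec_ne_zero (abs_det_normalize w) hv
  have hppos := vnorm_pos.2 hp0
  have hvpos := vnorm_pos.2 hv
  refine ⟨hp0, fun A hA => ?_⟩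
  set b := ‖normalize w‖ with hb
  have hb1 : 1 ≤ b := one_le_norm_normalize w
  set a := ‖normalize A‖ with ha
  have ha1 : 1 ≤ a := one_le_norm_normalize A
  have h1 : κ * a * b / 2 < ‖normalize (A * w)‖ := by
    have h2 := hmul A w hA hw
    have h3 : 0 < κ * a * b := by positivity
    linarith
  -- a vector `y` whose image `q = w y` is well expanded by `A`; compare `p` with `q`
  obtain ⟨y, hy0, hy⟩ := exists_lt_vnorm_mulVec (by positivity) h1
  rw [map_mul, ← Matrix.mulVec_mulVec] at hy
  set q := (normalize w).mulVec y with hq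
  have hypos := vnorm_pos.2 hy0
  have hqb : vnorm q ≤ b * vnorm y := vnorm_mulVec_le _ _
  have harea : |area p q| ≤ vnorm v * vnorm y := by
    rw [hp, hq, abs_area_mulVec (abs_det_normalize w)]; exact abs_area_le _ _
  have e := eq_smul_add_rot hp0 q
  have h5 : vnorm ((normalize A).mulVec q) ≤
      |slope p q| * vnorm ((normalize A).mulVec p) + |area p q| / vnorm p ^ 2 * (a * vnorm p) := by
    conv_lhs => rw [e, Matrix.mulVec_add, Matrix.mulVec_smul, Matrix.mulVec_smul]
    refine (vnorm_add_le _ _).trans ?_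
    rw [vnorm_smul, vnorm_smul, abs_div (area p q), abs_of_pos (pow_pos hppos 2)]
    have := vnorm_mulVec_le (normalize A) (rot p)
    rw [vnorm_rot] at this
    exact add_le_add le_rfl (mul_le_mul_of_nonneg_left this (by positivity))
  set t := vnorm ((normalize A).mulVec p) with ht
  have h6 : |slope p q| * vnorm p ≤ b * vnorm y := (abs_slope_mul_le p q).trans hqb
  have h7 : |slope p q| * t ≤ b * vnorm y / vnorm p * t := by
    refine mul_le_mul_of_nonneg_right ?_ (vnorm_nonneg _)
    rwa [le_div_iff₀ hppos]
  have h8 : |area p q| / vnorm p ^ 2 * (a * vnorm p) ≤ vnorm v * vnorm y / vnorm p * a := by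
    have e2 : |area p q| / vnorm p ^ 2 * (a * vnorm p) = |area p q| / vnorm p * a := by
      field_simp
    rw [e2]
    gcongr
  have h9 : κ * a * b / 2 * vnorm y < (b * t + vnorm v * a) * vnorm y / vnorm p := by
    calc κ * a * b / 2 * vnorm y < _ := hy
      _ ≤ _ := h5
      _ ≤ b * vnorm y / vnorm p * t + vnorm v * vnorm y / vnorm p * a := add_le_add h7 h8
      _ = _ := by ring
  rw [lt_div_iff₀ hppos] at h9
  have h10 : κ * a * b / 2 * vnorm p ≤ b * t + vnorm v * a := by
    refine le_of_mul_le_mul_right ?_ hypos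
    linarith
  have h11 : vnorm v * a ≤ κ * a * b / 4 * vnorm p := by
    rw [div_le_iff₀ (by positivity)] at hnorm
    calc vnorm v * a = 4 * (vnorm v * a) / 4 := by ring
      _ ≤ b ^ 2 * (η * κ) * (vnorm v * a) / 4 := by gcongr
      _ = κ * a * b / 4 * (η * b * vnorm v) := by ring
      _ ≤ κ * a * b / 4 * vnorm p := by gcongr
  refine le_of_mul_le_mul_left ?_ (by linarith : 0 < b)
  linarith

theorem exists_list_of_mem_pow {j : ℕ} {w : GL (Fin 2) ℝ} (hw : w ∈ 𝒜 ^ j) :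
    ∃ l : List (GL (Fin 2) ℝ), l.length = j ∧ (∀ A ∈ l, A ∈ 𝒜) ∧ l.prod = w := by
  induction j generalizing w with
  | zero => exact ⟨[], rfl, by simp, by simpa using hw.symm⟩
  | succ j ih =>
    rw [pow_succ'] at hw
    obtain ⟨A, hA, u, hu, rfl⟩ := Set.mem_mul.1 hw
    obtain ⟨l, hl, hl', rfl⟩ := ih hu
    refine ⟨A :: l, by simp [hl], fun B hB => ?_, by simp⟩
    rcases List.mem_cons.1 hB with rfl | hB
    exacts [hA, hl' B hB]

theorem mem_closure_of_mem_pow {j : ℕ} {w : GL (Fin 2) ℝ} (hw : w ∈ 𝒜 ^ j) :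
    w ∈ Subsemigroup.closure 𝒜 ∨ w = 1 := by
  obtain ⟨l, -, hl, rfl⟩ := exists_list_of_mem_pow hw
  exact list_prod_mem_closure hl

theorem isCompact_pow (h𝒜 : IsCompact 𝒜) (j : ℕ) : IsCompact (𝒜 ^ j) := by
  induction j with
  | zero => rw [pow_zero]; exact isCompact_singleton
  | succ j ih => rw [pow_succ]; exact ih.mul h𝒜

/-- A dominated set which generates an almost multiplicative semigroup maps some open cone `O`
into a compact part of it. The cone is a union of images of slowly widening expanded cones under
short words, so that one more letter always leads to the interior. -/
theorem exists_absorbing_cone (h𝒜 : IsCompact 𝒜) (hne : 𝒜.Nonempty) (hdom : IsDominated 𝒜)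
    (hAM : IsAlmostMultiplicative (Subsemigroup.closure 𝒜)) :
    ∃ K O : Set (Fin 2 → ℝ), IsCompact K ∧ K.Nonempty ∧ (∀ v ∈ K, v ≠ 0) ∧ IsOpen O ∧ K ⊆ O ∧
      (∀ c : ℝ, c ≠ 0 → ∀ v ∈ O, c • v ∈ O) ∧ (∃ z, z ≠ 0 ∧ z ∉ O) ∧
      ∀ A ∈ 𝒜, ∀ v ∈ O, ∃ c : ℝ, c ≠ 0 ∧ c • (normalize A).mulVec v ∈ K := by
  obtain ⟨κ, hκ, hκ1, hmul⟩ := isAlmostMultiplicative_iff.1 hAM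
  obtain ⟨a, Λ, ha, hΛ, hgrow⟩ := hdom.exists_growth
  have hlong : ∀ R : ℝ, ∃ N : ℕ, 1 ≤ N ∧ ∀ w ∈ 𝒜 ^ N, R < ‖normalize w‖ ^ 2 := fun R => by
    obtain ⟨n, hn⟩ := pow_unbounded_of_one_lt (|R| / a) hΛ
    have hn' : |R| / a < Λ ^ (n + 1) :=
      hn.trans_le (pow_le_pow_right₀ hΛ.le (Nat.le_succ n))
    refine ⟨n + 1, by omega, fun w hw => ?_⟩
    obtain ⟨l, hl, hl', rfl⟩ := exists_list_of_mem_pow hw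
    have h1 := hgrow l hl'
    rw [hl] at h1
    rw [div_lt_iff₀' ha] at hn'
    have h2 := one_le_norm_normalize l.prod
    nlinarith [le_abs_self R]
  set η : ℕ → ℝ := fun j => κ / 16 * (1 + 1 / ((j : ℝ) + 1)) with hη
  have hη0 : η 0 = κ / 8 := by simp [hη]; ring
  have hηlt : ∀ j, η (j + 1) < η j := fun j => by
    simp only [hη]
    have : (1 : ℝ) / (((j + 1 : ℕ) : ℝ) + 1) < 1 / ((j : ℝ) + 1) := by
      apply one_div_lt_one_div_of_lt (by positivity)
      push_cast; linarith
    gcongr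
  have hηge : ∀ j, κ / 16 ≤ η j := fun j => by
    simp only [hη]
    exact le_mul_of_one_le_right (by positivity) (by
      have : (0 : ℝ) < 1 / ((j : ℝ) + 1) := by positivity
      linarith)
  have hηpos : ∀ j, 0 < η j := fun j => lt_of_lt_of_le (by positivity) (hηge j)
  have hmono : ∀ {x y : ℝ}, x ≤ y → expandedCone 𝒜 y ⊆ expandedCone 𝒜 x :=
    fun {x y} hxy v hv => ⟨hv.1, fun w hw => le_trans (by
      have := vnorm_nonneg v
      gcongr) (hv.2 w hw)⟩
  obtain ⟨N, hN1, hN⟩ := hlong (4 / (κ / 16 * κ))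
  set D : Set (Fin 2 → ℝ) := {v | ∃ j < N, ∃ w ∈ 𝒜 ^ j, ∃ u ∈ expandedCone 𝒜 (η j),
    v = (normalize w).mulVec u} with hD
  set K : Set (Fin 2 → ℝ) := ⋃ j ∈ Finset.range N,
    (fun x : GL (Fin 2) ℝ × (Fin 2 → ℝ) => (normalize x.1).mulVec x.2) ''
      ((𝒜 ^ (j + 1)) ×ˢ (expandedCone 𝒜 (η j) ∩ {v | vnorm v = 1})) with hK
  have hKmem : ∀ v, v ∈ K ↔ ∃ j < N, ∃ w ∈ 𝒜 ^ (j + 1), ∃ u ∈ expandedCone 𝒜 (η j),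
      vnorm u = 1 ∧ v = (normalize w).mulVec u := fun v => by
    simp only [hK, Set.mem_iUnion, Finset.mem_range, exists_prop]
    refine exists_congr fun j => and_congr_right fun _ => ⟨?_, ?_⟩
    · rintro ⟨⟨w, u⟩, ⟨hw, hu, hu1⟩, rfl⟩
      exact ⟨w, hw, u, hu, hu1, rfl⟩
    · rintro ⟨w, hw, u, hu, hu1, rfl⟩
      exact ⟨⟨w, u⟩, ⟨hw, hu, hu1⟩, rfl⟩
  have hnhds : ∀ {j : ℕ} {w : GL (Fin 2) ℝ} {u : Fin 2 → ℝ} {x : ℝ}, j < N → w ∈ 𝒜 ^ j →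
      u ∈ expandedCone 𝒜 x → η j < x → D ∈ 𝓝 ((normalize w).mulVec u) := by
    intro j w u x hj hw hu hx
    have hcont : Continuous fun y : Fin 2 → ℝ => (normalize w⁻¹).mulVec y := by fun_prop
    have h1 := hcont.continuousAt.preimage_mem_nhds (x := (normalize w).mulVec u)
      (t := expandedCone 𝒜 (η j)) (by
        rw [normalize_inv_mulVec]; exact expandedCone_mem_nhds hx hu)
    filter_upwards [h1] with y hy
    exact ⟨j, hj, w, hw, _, hy, (normalize_mulVec_inv w y).symm⟩
  refine ⟨K, {v | D ∈ 𝓝 v}, ?_, ?_, ?_, ?_, ?_, ?_, ?_, ?_⟩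
  · refine (Finset.range N).isCompact_biUnion fun j _ =>
      ((isCompact_pow h𝒜 (j + 1)).prod (isCompact_expandedCone_inter _)).image ?_
    exact (continuous_normalize.comp continuous_fst).matrix_mulVec continuous_snd
  · -- the most expanded direction of a long word
    obtain ⟨n, hn1, hn⟩ := hlong (4 / (1 / 2 * κ))
    obtain ⟨A, hA⟩ := hne
    have hw := hn (A ^ n) (Set.pow_mem_pow hA)
    have h1 := one_le_norm_normalize (A ^ n)
    obtain ⟨v, hv, hv'⟩ := exists_lt_vnorm_mulVec (A := normalize (A ^ n))
      (c := ‖normalize (A ^ n)‖ / 2) (by positivity) (by linarith)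
    have h2 := mulVec_mem_expandedCone_of_norm_ge hκ (η := 1 / 2) (by norm_num) hmul
      (pow_mem_closure (Subsemigroup.subset_closure hA) n) hv (by linarith) hw.le
    have h3 := hmono (by rw [hη0]; linarith : η 0 ≤ κ / 4) h2
    have h4 := vnorm_pos.2 h3.1
    exact ⟨_, (hKmem _).2 ⟨0, hN1, A, by simpa using hA, _,
      smul_mem_expandedCone (inv_ne_zero h4.ne') h3, vnorm_unit h3.1, rfl⟩⟩
  · intro v hv
    obtain ⟨j, -, w, -, u, hu, -, rfl⟩ := (hKmem v).1 hv
    exact mulVec_ne_zero (abs_det_normalize w) hu.1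
  · exact interior_eq_nhds' (s := D) ▸ isOpen_interior
  · intro v hv
    obtain ⟨j, hj, w, hw, u, hu, -, rfl⟩ := (hKmem v).1 hv
    rcases (show j + 1 ≤ N from hj).eq_or_lt with h | h
    · have h1 := mulVec_mem_expandedCone_of_norm_ge hκ (η := κ / 16) (by positivity) hmul
        (mem_closure_of_mem_pow hw) hu.1 ((hmono (hηge j) hu).2 w (mem_closure_of_mem_pow hw))
        (hN w (by rwa [← h])).le
      have h2 := hnhds (j := 0) (w := 1) hN1 (by simp) h1 (by rw [hη0]; linarith)
      rwa [map_one, Matrix.one_mulVec] at h2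
    · exact hnhds h hw hu (hηlt j)
  · intro c hc v hv
    have hcont : Continuous fun y : Fin 2 → ℝ => c⁻¹ • y := by fun_prop
    have h1 := hcont.continuousAt.preimage_mem_nhds (x := c • v) (t := D) (by
      rwa [smul_smul, inv_mul_cancel₀ hc, one_smul])
    filter_upwards [h1] with y hy
    obtain ⟨j, hj, w, hw, u, hu, hyu⟩ := hy
    refine ⟨j, hj, w, hw, c • u, smul_mem_expandedCone hc hu, ?_⟩
    rw [Matrix.mulVec_smul, ← hyu, smul_smul, mul_inv_cancel₀ hc, one_smul]
  · -- the most contracted direction of a long word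
    obtain ⟨n, hn1, hn⟩ := hlong (2 / (κ * (κ / 16)))
    obtain ⟨A, hA⟩ := hne
    have hw := hn (A ^ n) (Set.pow_mem_pow hA)
    obtain ⟨z, hz1, hz2⟩ := exists_contracted (abs_det_normalize (A ^ n))
    refine ⟨z, vnorm_pos.1 (by rw [hz1]; exact one_pos), fun hz => ?_⟩
    obtain ⟨j, hj, w, hw', u, hu, rfl⟩ := mem_of_mem_nhds hz
    have h1 := (mulVec_mem_expandedCone (by positivity) hmul (mem_closure_of_mem_pow hw') hκ.le
      (hmono (hηge j) hu)).2 _ (pow_mem_closure (Subsemigroup.subset_closure hA) n)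
    rw [hz1, mul_one] at h1
    rw [div_lt_iff₀ (by positivity)] at hw
    nlinarith [mul_le_mul_of_nonneg_right h1 (norm_nonneg (normalize (A ^ n)))]
  · intro A hA v hv
    obtain ⟨j, hj, w, hw, u, hu, rfl⟩ := mem_of_mem_nhds hv
    have hu0 := vnorm_pos.2 hu.1
    refine ⟨(vnorm u)⁻¹, inv_ne_zero hu0.ne', (hKmem _).2 ⟨j, hj, A * w, ?_, (vnorm u)⁻¹ • u,
      smul_mem_expandedCone (inv_ne_zero hu0.ne') hu, vnorm_unit hu.1, ?_⟩⟩
    · rw [pow_succ']; exact Set.mul_mem_mul hA hw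
    · rw [Matrix.mulVec_smul, map_mul, Matrix.mulVec_mulVec]

end ExpandedCone

/-! ### The projective line -/

/-- The cone over a set of lines: the nonzero vectors spanning a line in the set. -/
def coneOver (C : Set RP1) : Set (Fin 2 → ℝ) :=
  {v | ∃ h : v ≠ 0, Projectivization.mk ℝ v h ∈ C}

theorem mk_eq_mk_of_smul {v w : Fin 2 → ℝ} (hv : v ≠ 0) (hw : w ≠ 0) {c : ℝ} (h : w = c • v) :
    (Projectivization.mk ℝ w hw : RP1) = Projectivization.mk ℝ v hv :=
  (Projectivization.mk_eq_mk_iff' ℝ w v hw hv).2 ⟨c, h.symm⟩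

theorem smul_mem_coneOver {C : Set RP1} {c : ℝ} (hc : c ≠ 0) {v : Fin 2 → ℝ}
    (hv : v ∈ coneOver C) : c • v ∈ coneOver C := by
  obtain ⟨h, hC⟩ := hv
  exact ⟨smul_ne_zero hc h, by rwa [mk_eq_mk_of_smul h (smul_ne_zero hc h) rfl]⟩

theorem isOpen_coneOver {C : Set RP1} (hC : IsOpen C) : IsOpen (coneOver C) := by
  have h1 : IsOpen {v : {v : Fin 2 → ℝ // v ≠ 0} | Projectivization.mk' ℝ v ∈ C} := hC
  have h2 := (isOpen_ne (x := (0 : Fin 2 → ℝ))).isOpenEmbedding_subtypeVal.isOpenMap _ h1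
  convert h2 using 1
  ext v
  constructor
  · rintro ⟨h, hv⟩
    exact ⟨⟨v, h⟩, hv, rfl⟩
  · rintro ⟨w, hw, rfl⟩
    exact ⟨w.2, hw⟩

/-- An open set of vectors contained in the cone over `C` projects into the interior of `C`. -/
theorem mk_mem_interior {C : Set RP1} {O : Set (Fin 2 → ℝ)} (hO : IsOpen O)
    (hOC : ∀ v ∈ O, v ≠ 0 → v ∈ coneOver C) {v : Fin 2 → ℝ} (h : v ≠ 0) (hv : v ∈ O) :
    Projectivization.mk ℝ v h ∈ interior C := by
  refine mem_interior.2 ⟨{x | ∃ c : ℝ, c ≠ 0 ∧ c • x.rep ∈ O}, ?_, ?_, ?_⟩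
  · rintro x ⟨c, hc, hx⟩
    obtain ⟨h1, h2⟩ := hOC _ hx (smul_ne_zero hc x.rep_nonzero)
    rwa [mk_eq_mk_of_smul x.rep_nonzero h1 rfl, Projectivization.mk_rep] at h2
  · change IsOpen {w : {v : Fin 2 → ℝ // v ≠ 0} |
      ∃ c : ℝ, c ≠ 0 ∧ c • (Projectivization.mk' ℝ w).rep ∈ O}
    have e : {w : {v : Fin 2 → ℝ // v ≠ 0} |
        ∃ c : ℝ, c ≠ 0 ∧ c • (Projectivization.mk' ℝ w).rep ∈ O} =
        ⋃ (c : ℝ) (_ : c ≠ 0), (fun w : {v : Fin 2 → ℝ // v ≠ 0} => c • (w : Fin 2 → ℝ)) ⁻¹' O := by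
      ext w
      obtain ⟨a, ha⟩ := Projectivization.exists_smul_eq_mk_rep ℝ (w : Fin 2 → ℝ) w.2
      have ha' : (Projectivization.mk' ℝ w).rep = (a : ℝ) • (w : Fin 2 → ℝ) := ha.symm
      simp only [Set.mem_ofPred_eq, Set.mem_iUnion, Set.mem_preimage, exists_prop, ha', smul_smul]
      constructor
      · rintro ⟨c, hc, hx⟩
        exact ⟨c * a, mul_ne_zero hc a.ne_zero, hx⟩
      · rintro ⟨c, hc, hx⟩
        refine ⟨c * (a : ℝ)⁻¹, mul_ne_zero hc (inv_ne_zero a.ne_zero), ?_⟩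
        rwa [mul_assoc, inv_mul_cancel₀ a.ne_zero, mul_one]
    rw [e]
    exact isOpen_iUnion fun c => isOpen_iUnion fun _ => hO.preimage (by fun_prop)
  · obtain ⟨a, ha⟩ := Projectivization.exists_smul_eq_mk_rep ℝ v h
    refine ⟨(a : ℝ)⁻¹, inv_ne_zero a.ne_zero, ?_⟩
    rw [← ha, Units.smul_def, smul_smul, inv_mul_cancel₀ a.ne_zero, one_smul]
    exact hv

theorem smul_mk (A : GL (Fin 2) ℝ) {v : Fin 2 → ℝ} (hv : v ≠ 0) :
    A • (Projectivization.mk ℝ v hv : RP1) =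
      Projectivization.mk ℝ ((normalize A).mulVec v) (mulVec_ne_zero (abs_det_normalize A) hv) := by
  have hne : (A : Matrix (Fin 2) (Fin 2) ℝ).mulVec v ≠ 0 := fun h0 =>
    mulVec_ne_zero (abs_det_normalize A) hv (by
      rw [normalize_apply, Matrix.smul_mulVec, h0, smul_zero])
  have h1 : A • (Projectivization.mk ℝ v hv : RP1) =
    Projectivization.mk ℝ ((A : Matrix (Fin 2) (Fin 2) ℝ).mulVec v) hne := rfl
  rw [h1]
  exact (mk_eq_mk_of_smul hne _ (by rw [normalize_apply, Matrix.smul_mulVec])).symm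

/-- The unit vector at angle `θ`. -/
def dir (θ : ℝ) : Fin 2 → ℝ := ![Real.cos θ, Real.sin θ]

theorem area_dir (θ ψ : ℝ) : area (dir θ) (dir ψ) = Real.sin (ψ - θ) := by
  simp [area, dir, Real.sin_sub]; ring

theorem continuous_dir : Continuous dir := by
  refine continuous_pi fun i => ?_
  fin_cases i
  · exact Real.continuous_cos
  · exact Real.continuous_sin

theorem exists_eq_smul_dir {v : Fin 2 → ℝ} (hv : v ≠ 0) : ∃ r θ : ℝ, r ≠ 0 ∧ v = r • dir θ := by
  refine ⟨‖(⟨v 0, v 1⟩ : ℂ)‖, Complex.arg ⟨v 0, v 1⟩, ?_, ?_⟩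
  · rw [norm_ne_zero_iff]
    intro h
    refine hv ?_
    ext i
    fin_cases i
    · exact congrArg Complex.re h
    · exact congrArg Complex.im h
  · ext i
    fin_cases i
    · exact (Complex.norm_mul_cos_arg ⟨v 0, v 1⟩).symm
    · exact (Complex.norm_mul_sin_arg ⟨v 0, v 1⟩).symm

theorem exists_eq_smul_dir_Ico {v : Fin 2 → ℝ} (hv : v ≠ 0) (a : ℝ) :
    ∃ r θ : ℝ, r ≠ 0 ∧ a ≤ θ ∧ θ < a + Real.pi ∧ v = r • dir θ := by
  obtain ⟨r, θ, hr, rfl⟩ := exists_eq_smul_dir hv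
  set n := toIcoDiv Real.pi_pos a θ with hn
  have hmem := toIcoMod_mem_Ico Real.pi_pos a θ
  have hθ : θ = toIcoMod Real.pi_pos a θ + n * Real.pi := by
    have := toIcoMod_add_toIcoDiv_zsmul Real.pi_pos a θ
    rw [zsmul_eq_mul] at this
    exact this.symm
  set ψ := toIcoMod Real.pi_pos a θ
  refine ⟨r * (-1) ^ n, ψ, mul_ne_zero hr (zpow_ne_zero _ (by norm_num)), hmem.1, hmem.2, ?_⟩
  rw [mul_smul, hθ]
  congr 1
  ext i
  fin_cases i
  · simp [dir, Real.cos_add_int_mul_pi]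
  · simp [dir, Real.sin_add_int_mul_pi]

/-- The cone over a closed projective interval is given by a quadratic inequality. -/
theorem mem_coneOver_interval {a b : ℝ} (hab : a < b) (hba : b < a + Real.pi) {v : Fin 2 → ℝ}
    (hv : v ≠ 0) : v ∈ coneOver (lineAt '' Set.Icc a b) ↔
      0 ≤ area (dir a) v * area v (dir b) := by
  constructor
  · rintro ⟨_, θ, ⟨h1, h2⟩, h3⟩
    obtain ⟨c, rfl⟩ :=
      (Projectivization.mk_eq_mk_iff' ℝ v (dir θ) hv (direction_ne_zero θ)).1 h3.symm
    rw [area_smul_left, area_smul_right, area_dir, area_dir]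
    have h4 := Real.sin_nonneg_of_nonneg_of_le_pi (x := θ - a) (by linarith) (by linarith)
    have h5 := Real.sin_nonneg_of_nonneg_of_le_pi (x := b - θ) (by linarith) (by linarith)
    have h6 : c * Real.sin (θ - a) * (c * Real.sin (b - θ)) =
      c ^ 2 * (Real.sin (θ - a) * Real.sin (b - θ)) := by ring
    rw [h6]
    positivity
  · intro h
    obtain ⟨r, θ, hr, h1, h2, rfl⟩ := exists_eq_smul_dir_Ico hv a
    rw [area_smul_left, area_smul_right, area_dir, area_dir] at h
    refine ⟨hv, θ, ⟨h1, ?_⟩, (mk_eq_mk_of_smul (direction_ne_zero θ) hv rfl).symm⟩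
    by_contra! hlt
    have h4 := Real.sin_pos_of_pos_of_lt_pi (x := θ - a) (by linarith) (by linarith)
    have h5 := Real.sin_neg_of_neg_of_neg_pi_lt (x := b - θ) (by linarith) (by linarith)
    have h6 : 0 < r ^ 2 := by positivity
    have h7 := mul_neg_of_pos_of_neg (mul_pos h6 h4) h5
    linarith

theorem isClosed_coneOver_interval {I : Set RP1} (hI : IsClosedProjectiveInterval I) :
    IsClosed (coneOver I ∪ {0}) := by
  obtain ⟨a, b, hab, hba, rfl⟩ := hI
  have e : coneOver (lineAt '' Set.Icc a b) ∪ {0} =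
      {v | 0 ≤ area (dir a) v * area v (dir b)} := by
    ext v
    by_cases hv : v = 0
    · simp [hv, area]
    · rw [Set.mem_union, mem_coneOver_interval hab hba hv]
      simp [hv]
  rw [e]
  exact isClosed_le (by fun_prop) (by fun_prop)

theorem IsMulticone.isClosed_coneOver {C : Set RP1} (hC : IsMulticone C) :
    IsClosed (coneOver C ∪ {0}) := by
  obtain ⟨-, -, F, hF, hFI, rfl⟩ := hC
  have e : coneOver (⋃₀ F) ∪ {0} = (⋃ I ∈ F, (coneOver I ∪ {0})) ∪ {0} := by
    ext v
    simp only [coneOver, Set.mem_union, Set.mem_ofPred_eq, Set.mem_sUnion, Set.mem_iUnion,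
      Set.mem_singleton_iff, exists_prop]
    constructor
    · rintro (⟨h, I, hI, hv⟩ | h)
      · exact .inl ⟨I, hI, .inl ⟨h, hv⟩⟩
      · exact .inr h
    · rintro (⟨I, hI, ⟨h, hv⟩ | h⟩ | h)
      · exact .inl ⟨h, I, hI, hv⟩
      · exact .inr h
      · exact .inr h
  rw [e]
  exact (hF.isClosed_biUnion fun I hI => isClosed_coneOver_interval (hFI I hI)).union
    isClosed_singleton

theorem IsStronglyInvariantMulticone.isInvariantCone {𝒜 : Set (GL (Fin 2) ℝ)} {C : Set RP1}
    (hC : IsStronglyInvariantMulticone 𝒜 C) :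
    IsInvariantCone 𝒜 (coneOver C) (coneOver (interior C)) where
  ne_zero _ hv := hv.1
  smul_mem _ hc _ hv := smul_mem_coneOver hc hv
  smul_mem' _ hc _ hv := smul_mem_coneOver hc hv
  subset _ hv := ⟨hv.1, interior_subset hv.2⟩
  isClosed := hC.1.isClosed_coneOver
  isOpen := isOpen_coneOver isOpen_interior
  mapsTo A hA v hv := by
    obtain ⟨h, hvC⟩ := hv
    refine ⟨mulVec_ne_zero (abs_det_normalize A) h, ?_⟩
    rw [← smul_mk A h]
    exact hC.2 A hA (Set.smul_mem_smul_set hvC)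

/-- Every line in an open cone lies in the interior of a closed projective interval contained in the
cone. -/
theorem exists_interval {O : Set (Fin 2 → ℝ)} (hO : IsOpen O)
    (hOs : ∀ c : ℝ, c ≠ 0 → ∀ v ∈ O, c • v ∈ O) {p : Fin 2 → ℝ} (hp : p ≠ 0) (hpO : p ∈ O) :
    ∃ I, IsClosedProjectiveInterval I ∧ coneOver I ⊆ O ∧ ∃ W : Set (Fin 2 → ℝ), IsOpen W ∧ p ∈ W ∧
      ∀ v ∈ W, v ∈ coneOver I := by
  obtain ⟨r, θ, hr, rfl⟩ := exists_eq_smul_dir hp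
  have hθ : dir θ ∈ O := by
    have := hOs r⁻¹ (inv_ne_zero hr) _ hpO
    rwa [smul_smul, inv_mul_cancel₀ hr, one_smul] at this
  obtain ⟨ε, hε, hball⟩ := Metric.isOpen_iff.1 (hO.preimage continuous_dir) θ hθ
  set ρ := min (ε / 2) 1 with hρ
  have hρ0 : 0 < ρ := by positivity
  have hρ1 : ρ ≤ 1 := min_le_right _ _
  have hρε : ρ ≤ ε / 2 := min_le_left _ _
  have hπ := Real.pi_gt_three
  refine ⟨lineAt '' Set.Icc (θ - ρ) (θ + ρ), ⟨_, _, by linarith, by linarith, rfl⟩, ?_,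
    {v | 0 < area (dir (θ - ρ)) v * area v (dir (θ + ρ))}, ?_, ?_, ?_⟩
  · rintro v ⟨hv, ψ, ⟨h1, h2⟩, h3⟩
    obtain ⟨c, rfl⟩ :=
      (Projectivization.mk_eq_mk_iff' ℝ v (dir ψ) hv (direction_ne_zero ψ)).1 h3.symm
    refine hOs c (fun h => hv (by rw [h, zero_smul])) _ (hball ?_)
    rw [Metric.mem_ball, Real.dist_eq, abs_lt]
    constructor <;> linarith
  · exact isOpen_lt (by fun_prop) (by fun_prop)
  · have h4 := Real.sin_pos_of_pos_of_lt_pi (x := ρ) (by linarith) (by linarith)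
    have h6 : 0 < r ^ 2 := by positivity
    simp only [Set.mem_ofPred_eq, area_smul_left, area_smul_right, area_dir, sub_sub_cancel,
      add_sub_cancel_left]
    have := mul_pos h6 (mul_pos h4 h4)
    linarith
  · intro v hv
    have hv0 : v ≠ 0 := by
      rintro rfl
      simp [area] at hv
    exact (mem_coneOver_interval (by linarith) (by linarith) hv0).2 (le_of_lt hv)

theorem exists_isMulticone : ∃ C, IsMulticone C := by
  have hπ := Real.pi_gt_three
  refine ⟨lineAt '' Set.Icc 0 1, ⟨lineAt 0, 0, by simp, rfl⟩, fun h => ?_, {lineAt '' Set.Icc 0 1},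
    Set.finite_singleton _, ?_, by simp⟩
  · have h1 : dir (-1) ∈ coneOver (lineAt '' Set.Icc 0 1) :=
      ⟨direction_ne_zero _, by rw [h]; trivial⟩
    rw [mem_coneOver_interval zero_lt_one (by linarith)
      (show dir (-1) ≠ 0 from direction_ne_zero _), area_dir, area_dir] at h1
    have h2 := Real.sin_pos_of_pos_of_lt_pi (x := 1 - -1) (by linarith) (by linarith)
    have h3 := Real.sin_neg_of_neg_of_neg_pi_lt (x := -1 - 0) (by linarith) (by linarith)
    nlinarith [mul_neg_of_neg_of_pos h3 h2]
  · rintro I rfl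
    exact ⟨0, 1, by norm_num, by linarith, rfl⟩

theorem exists_isStronglyInvariantMulticone {𝒜 : Set (GL (Fin 2) ℝ)} (h𝒜 : IsCompact 𝒜)
    (hdom : IsDominated 𝒜) : ∃ C, IsStronglyInvariantMulticone 𝒜 C := by
  rcases 𝒜.eq_empty_or_nonempty with rfl | hne
  · obtain ⟨C, hC⟩ := exists_isMulticone
    exact ⟨C, hC, by simp⟩
  obtain ⟨K, O, hK, hKne, hK0, hO, hKO, hOs, ⟨z, hz, hzO⟩, hmaps⟩ :=
    exists_absorbing_cone h𝒜 hne hdom (hdom.isAlmostMultiplicative h𝒜)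
  choose! I hI hIsub W hW hpW hWI using fun p (hp : p ∈ K) =>
    exists_interval hO hOs (hK0 p hp) (hKO hp)
  obtain ⟨t, htK, htcov⟩ := hK.elim_nhds_subcover W fun p hp => (hW p hp).mem_nhds (hpW p hp)
  set C : Set RP1 := ⋃₀ (I '' (t : Set (Fin 2 → ℝ))) with hC
  have hCO : coneOver C ⊆ O := by
    rintro v ⟨hv, J, ⟨p, hp, rfl⟩, hvJ⟩
    exact hIsub p (htK p hp) ⟨hv, hvJ⟩
  have hKC : ∀ v (hv : v ∈ K), Projectivization.mk ℝ v (hK0 v hv) ∈ interior C := by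
    intro v hv
    obtain ⟨p, hp, hvp⟩ := Set.mem_iUnion₂.1 (htcov hv)
    refine mk_mem_interior (hW p (htK p hp)) (fun w hw _ => ?_) (hK0 v hv) hvp
    obtain ⟨h1, h2⟩ := hWI p (htK p hp) w hw
    exact ⟨h1, Set.mem_sUnion.2 ⟨I p, ⟨p, hp, rfl⟩, h2⟩⟩
  refine ⟨C, ⟨?_, ?_, I '' (t : Set (Fin 2 → ℝ)), t.finite_toSet.image I, ?_, rfl⟩, ?_⟩
  · obtain ⟨v, hv⟩ := hKne
    exact ⟨_, interior_subset (hKC v hv)⟩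
  · intro h
    exact hzO (hCO ⟨hz, by rw [h]; trivial⟩)
  · rintro J ⟨p, hp, rfl⟩
    exact hI p (htK p hp)
  · rintro A hA _ ⟨x, hx, rfl⟩
    induction x using Projectivization.ind with
    | h v hv =>
      obtain ⟨c, hc, hcK⟩ := hmaps A hA v (hCO ⟨hv, hx⟩)
      have := hKC _ hcK
      rw [mk_eq_mk_of_smul (mulVec_ne_zero (abs_det_normalize A) hv) _ rfl, ← smul_mk A hv] at this
      exact this

theorem IsStronglyInvariantMulticone.isProximal_and_isAlmostMultiplicative
    {𝒜 : Set (GL (Fin 2) ℝ)} (h𝒜 : IsCompact 𝒜) {C : Set RP1}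
    (hC : IsStronglyInvariantMulticone 𝒜 C) :
    (∀ A ∈ 𝒜, IsProximal A) ∧ IsAlmostMultiplicative (Subsemigroup.closure 𝒜) := by
  have hcone := hC.isInvariantCone
  have hne : (coneOver C).Nonempty := by
    obtain ⟨x, hx⟩ := hC.1.1
    exact ⟨x.rep, x.rep_nonzero, by rwa [Projectivization.mk_rep]⟩
  have hproper : ∃ z, z ≠ 0 ∧ z ∉ coneOver C := by
    obtain ⟨x, hx⟩ := (Set.ne_univ_iff_exists_notMem C).1 hC.1.2.1
    refine ⟨x.rep, x.rep_nonzero, fun ⟨_, h⟩ => hx ?_⟩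
    rwa [Projectivization.mk_rep] at h
  exact ⟨fun A hA => hcone.isProximal h𝒜 hne hproper hA,
    hcone.isAlmostMultiplicative h𝒜 hne hproper⟩

end

end PlanarCocycle

theorem corollary2p4 (𝒜 : Set (GL (Fin 2) ℝ)) (h𝒜 : IsCompact 𝒜) :
    ((∃ C : Set PlanarCocycle.RP1, PlanarCocycle.IsStronglyInvariantMulticone 𝒜 C) ↔
      ((∀ A ∈ 𝒜, PlanarCocycle.IsProximal A) ∧
        PlanarCocycle.IsAlmostMultiplicative (Subsemigroup.closure 𝒜))) ∧
    ((∃ C : Set PlanarCocycle.RP1, PlanarCocycle.IsStronglyInvariantMulticone 𝒜 C) ↔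
      PlanarCocycle.IsDominated 𝒜) := by
  have h12 : (∃ C : Set PlanarCocycle.RP1, PlanarCocycle.IsStronglyInvariantMulticone 𝒜 C) →
      ((∀ A ∈ 𝒜, PlanarCocycle.IsProximal A) ∧
        PlanarCocycle.IsAlmostMultiplicative (Subsemigroup.closure 𝒜)) :=
    fun ⟨_, hC⟩ => hC.isProximal_and_isAlmostMultiplicative h𝒜
  have h23 : ((∀ A ∈ 𝒜, PlanarCocycle.IsProximal A) ∧
      PlanarCocycle.IsAlmostMultiplicative (Subsemigroup.closure 𝒜)) →
      PlanarCocycle.IsDominated 𝒜 :=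
    fun h => PlanarCocycle.isDominated_of_isProximal h𝒜 h.1 h.2
  have h31 : PlanarCocycle.IsDominated 𝒜 →
      ∃ C : Set PlanarCocycle.RP1, PlanarCocycle.IsStronglyInvariantMulticone 𝒜 C :=
    PlanarCocycle.exists_isStronglyInvariantMulticone h𝒜
  exact ⟨⟨h12, fun h => h31 (h23 h)⟩, fun h => h23 (h12 h), h31⟩
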